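/- A bi-umbilical foliated semi-symmetric hypersurface in $\mathbb E^4$ is a smoothly immersed 3-manifold $X:M^3\to\mathbb E^4$ which is of conullity two (the nullity space $\{v : R(v,w)z=0 \text{ for all } w,z\}$ of the curvature tensor of the induced metric is one-dimensional at every point) and whose second fundamental form at every point is $h=\nu(\eta_1\otimes\eta_1+\eta_2\otimes\eta_2)$ with $\nu\ne 0$ and orthonormal one-forms $\eta_1,\eta_2$. For real $a>0$, $b$ with $a^2+b^2=1$ and real $c_0,c_1,c_2,c_3$ put $$l(x,y)=\tfrac1{\cosh x}(a\cos y,\;a\sin y,\;a\sinh x,\;b\cosh x),\qquad n(x,y)=\tfrac1{\cosh x}(b\cos y,\;b\sin y,\;b\sinh x,\;-a\cosh x),$$ $$r(x,y)=c_0+\tfrac1{\cosh x}(c_1\cos y+c_2\sin y+c_3\sinh x),$$ $$Y(x,y,w)=r\,l+\tfrac{\cosh^2x}{a^2}\,(r_x\,l_x+r_y\,l_y)+w\,n,\qquad (x,y,w)\in\mathbb R^3 .$$ (1) Let $X:M^3\to\mathbb E^4$ be a connected bi-umbilical foliated semi-symmetric hypersurface and $p_0\in M$. Then there are constants $a,b,c_0,\dots,c_3$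 as above and a linear isometry $\Phi$ of $\mathbb E^4$ such that $X$ is $\Phi\circ Y$ up to parametrization, away from the two lines omitted by the coordinates $(x,y)$: if $p\in M$ and the first two coordinates of $\Phi^{-1}(X(p))$ are not $(c_1/a,c_2/a)$, then there is a smooth local coordinate system $(x,y,w)$ of $M$ around $p$ in which $X=\Phi(Y(x,y,w))$; and $p_0$ is such a point. (2) If $b\ne0$, then $Y(x,y,w)=f(x,y,w)\,n(x,y)+C$ with $$f(x,y,w)=\tfrac ab c_0+w-\tfrac{b}{a\cosh x}(c_1\cos y+c_2\sin y+c_3\sinh x),\qquad C=\left(\tfrac{c_1}a,\tfrac{c_2}a,\tfrac{c_3}a,\tfrac{c_0}b\right).$$ If $b=0$ (so $a=1$), then $Y(x,y,w)=\left(c_0\tfrac{\cos y}{\cosh x}+c_1,\;c_0\tfrac{\sin y}{\cosh x}+c_2,\;c_0\tanh x+c_3,\;-w\right)$, a spherical cylinder. (3) Conversely, for all such constants, $Y$ is bi-umbilical foliated semi-symmetric at every point of $\mathbb R^3$ at which it is an immersion. -/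

import Mathlib

open scoped Manifold ContDiff RealInnerProductSpace

noncomputable section

namespace BiUmbilical

/-- The space of parameters `ℝ³`. -/
abbrev E3 := EuclideanSpace ℝ (Fin 3)

/-- The Euclidean space `𝔼⁴`. -/
abbrev E4 := EuclideanSpace ℝ (Fin 4)

/-! ### Local geometry of a parametrized hypersurface `F : ℝ³ → 𝔼⁴` near a regular point -/

/-- The tangent space of the parametrized hypersurface at the point of parameter `q`. -/
def tangentSpaceAt (F : E3 → E4) (q : E3) : Submodule ℝ E4 :=
  LinearMap.range (fderiv ℝ F q : E3 →ₗ[ℝ] E4)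

/-- `N` is a unit normal vector of the hypersurface at `q`. -/
def IsUnitNormalAt (F : E3 → E4) (q : E3) (N : E4) : Prop :=
  ‖N‖ = 1 ∧ N ∈ (tangentSpaceAt F q)ᗮ

/-- The second fundamental form at `q` with respect to the normal vector `N`:
`h(v, w) = ⟨∂_w ∂_v F, N⟩`. -/
def secondFundamentalForm (F : E3 → E4) (q : E3) (N : E4) (v w : E3) : ℝ :=
  ⟪fderiv ℝ (fun s => fderiv ℝ F s v) q w, N⟫

/-- The Levi-Civita covariant derivative, in the direction of the constant coordinate field `v`,
of a vector field `Z` tangent to the hypersurface: the tangential part of the derivative of `Z`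
in `𝔼⁴`. -/
def covDeriv (F : E3 → E4) (v : E3) (Z : E3 → E4) (q : E3) : E4 :=
  (tangentSpaceAt F q).starProjection (fderiv ℝ Z q v)

/-- The Riemannian curvature `R(v, w) z = ∇_v ∇_w z - ∇_w ∇_v z` of the induced metric,
evaluated on constant coordinate fields (whose brackets vanish); the tangent field of `𝔼⁴`
corresponding to `z` is `s ↦ dF_s z`. -/
def curvature (F : E3 → E4) (q : E3) (v w z : E3) : E4 :=
  covDeriv F v (covDeriv F w (fun s => fderiv ℝ F s z)) q -
    covDeriv F w (covDeriv F v (fun s => fderiv ℝ F s z)) q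

/-- Conullity two at `q`: the nullity space `{v | ∀ w z, R(v, w) z = 0}` of the curvature
tensor of the three-dimensional induced metric has dimension `3 - 2 = 1`. -/
def IsConullityTwoAt (F : E3 → E4) (q : E3) : Prop :=
  ∃ Δ : Submodule ℝ E3, Module.finrank ℝ Δ = 1 ∧
    ∀ v : E3, v ∈ Δ ↔ ∀ w z : E3, curvature F q v w z = 0

/-- The second fundamental form at `q` is `h = ν (η₁ ⊗ η₁ + η₂ ⊗ η₂)` with `ν ≠ 0`, where
`η₁, η₂` are the unit one-forms dual to two orthonormal tangent vectors `e₁, e₂`. -/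
def HasEqualPrincipalCurvaturesAt (F : E3 → E4) (q : E3) : Prop :=
  ∃ N : E4, IsUnitNormalAt F q N ∧ ∃ ν : ℝ, ν ≠ 0 ∧
    ∃ e₁ ∈ tangentSpaceAt F q, ∃ e₂ ∈ tangentSpaceAt F q,
      ‖e₁‖ = 1 ∧ ‖e₂‖ = 1 ∧ ⟪e₁, e₂⟫ = 0 ∧
      ∀ v w : E3, secondFundamentalForm F q N v w =
        ν * (⟪e₁, fderiv ℝ F q v⟫ * ⟪e₁, fderiv ℝ F q w⟫ +
          ⟪e₂, fderiv ℝ F q v⟫ * ⟪e₂, fderiv ℝ F q w⟫)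

/-- At `q` the hypersurface is foliated semi-symmetric (of conullity two) and bi-umbilical. -/
def IsBiUmbilicalFoliatedAt (F : E3 → E4) (q : E3) : Prop :=
  IsConullityTwoAt F q ∧ HasEqualPrincipalCurvaturesAt F q

/-! ### Hypersurfaces -/

/-- A (smooth, immersed) bi-umbilical foliated semi-symmetric hypersurface in `𝔼⁴`: a smooth
immersion `X` of a three-dimensional manifold `M`, which is foliated semi-symmetric and
bi-umbilical at every point, in every local parametrization. -/
structure IsBiUmbilicalFoliatedHypersurface {M : Type*} [TopologicalSpace M]
    [ChartedSpace E3 M] (X : M → E4) : Prop where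
  smooth : ContMDiff 𝓘(ℝ, E3) 𝓘(ℝ, E4) ∞ X
  immersion : ∀ p : M, Function.Injective (mfderiv 𝓘(ℝ, E3) 𝓘(ℝ, E4) X p)
  biUmbilical : ∀ φ ∈ IsManifold.maximalAtlas 𝓘(ℝ, E3) ∞ M, ∀ q ∈ φ.target,
    IsBiUmbilicalFoliatedAt (X ∘ φ.symm) q

/-! ### The explicit hypersurfaces -/

/-- The isothermal parametrization of the sphere of radius `a` in the hyperplane `z⁴ = b`. -/
def l (a b x y : ℝ) : E4 :=
  (1 / Real.cosh x) •
    !₂[a * Real.cos y, a * Real.sin y, a * Real.sinh x, b * Real.cosh x]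

/-- The unit normal field of the sphere `l` in the unit sphere `S³`. -/
def n (a b x y : ℝ) : E4 :=
  (1 / Real.cosh x) •
    !₂[b * Real.cos y, b * Real.sin y, b * Real.sinh x, -(a * Real.cosh x)]

/-- The function `r = c₀ + (c₁ cos y + c₂ sin y + c₃ sinh x) / cosh x`. -/
def r (c : Fin 4 → ℝ) (x y : ℝ) : ℝ :=
  c 0 + 1 / Real.cosh x * (c 1 * Real.cos y + c 2 * Real.sin y + c 3 * Real.sinh x)

/-- The hypersurface `X = r l + (cosh² x / a²) (r_x l_x + r_y l_y) + w n`, the envelope of the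
hyperplanes `⟨z, l⟩ = r`. -/
def envelope (a b : ℝ) (c : Fin 4 → ℝ) (x y w : ℝ) : E4 :=
  r c x y • l a b x y +
    (Real.cosh x ^ 2 / a ^ 2 * deriv (fun s => r c s y) x) • deriv (fun s => l a b s y) x +
    (Real.cosh x ^ 2 / a ^ 2 * deriv (fun s => r c x s) y) • deriv (fun s => l a b x s) y +
    w • n a b x y

/-- The function `f` (used for `b ≠ 0`). -/
def f (a b : ℝ) (c : Fin 4 → ℝ) (x y w : ℝ) : ℝ :=
  a / b * c 0 + w -
    b / (a * Real.cosh x) * (c 1 * Real.cos y + c 2 * Real.sin y + c 3 * Real.sinh x)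

/-- The constant vector `C` (used for `b ≠ 0`). -/
def C (a b : ℝ) (c : Fin 4 → ℝ) : E4 :=
  !₂[c 1 / a, c 2 / a, c 3 / a, c 0 / b]

end BiUmbilical

end

open Filter Topology

noncomputable section

namespace BiUmbilical

/-! Part (1) comes from first integrals. Near a point let `N` be a smooth unit normal, `ν` the
double principal curvature and `e` the unit kernel field of the shape operator, and put η = ⟨e, dF⟩
and P = dF - η e; then dN = -ν P. Symmetry of the second derivatives of `N` (Codazzi) gives de = μ P
and dν = -μνη for some function μ (`structure_equations`), and symmetry for `e` gives dμ = -μ²η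
(`exists_dilation`). Hence κ = μ/ν and the axis A = e + κN are constant. The centre T = F + N/ν
satisfies dT = η A, so T = G + σA with G constant and orthogonal to A, and c₀ = σκ - 1/ν is constant
as well. Altogether F = G + c₀N + σ(A - κN), where N runs in the 2-sphere ⟨N, A⟩ = κ: a piece of a
spherical cone or cylinder (`exists_isConicalAt`).

The data (A, G, κ, c₀) are determined up to the signs of N and A (`IsConicalAt.unique`), so on a
connected manifold one choice works everywhere (`exists_forall_isConicalNear`). In an orthonormal
basis whose last vector is A/|A|, the normal becomes `l`, with a = 1/|A| and b = aκ, and κN - A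
becomes `n`. Sphere coordinates of N together with w = ⟨F, κN - A⟩ are the required chart
(`exists_envelope_coordinates`). They break down only where N is at a pole, that is, on the two
excluded lines.

Parts (2) and (3) rest on Y = v + c₀ l + height · n with v constant (`envelope_eq`), and on `n`
being an affine function of `l`: dY is then a multiple of dl plus a multiple of `n`, and `l` is a
unit normal. -/

/-! ### The explicit envelopes in closed form. -/

theorem hasDerivAt_vec4 {f₀ f₁ f₂ f₃ : ℝ → ℝ} {d₀ d₁ d₂ d₃ t : ℝ}
    (h₀ : HasDerivAt f₀ d₀ t) (h₁ : HasDerivAt f₁ d₁ t) (h₂ : HasDerivAt f₂ d₂ t)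
    (h₃ : HasDerivAt f₃ d₃ t) :
    HasDerivAt (fun s => (!₂[f₀ s, f₁ s, f₂ s, f₃ s] : E4)) !₂[d₀, d₁, d₂, d₃] t := by
  have : HasDerivAt (fun s => ![f₀ s, f₁ s, f₂ s, f₃ s]) ![d₀, d₁, d₂, d₃] t := by
    rw [hasDerivAt_pi]
    intro i
    fin_cases i <;> assumption
  exact (PiLp.continuousLinearEquiv 2 ℝ (fun _ : Fin 4 => ℝ)).symm.hasFDerivAt.comp_hasDerivAt t this

theorem fderiv_vec4 {f₀ f₁ f₂ f₃ : E3 → ℝ} {d₀ d₁ d₂ d₃ : E3 →L[ℝ] ℝ} {q : E3}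
    (h₀ : HasFDerivAt f₀ d₀ q) (h₁ : HasFDerivAt f₁ d₁ q) (h₂ : HasFDerivAt f₂ d₂ q)
    (h₃ : HasFDerivAt f₃ d₃ q) :
    ∀ v, fderiv ℝ (fun s => (!₂[f₀ s, f₁ s, f₂ s, f₃ s] : E4)) q v =
      !₂[d₀ v, d₁ v, d₂ v, d₃ v] := by
  have : HasFDerivAt (fun s => ![f₀ s, f₁ s, f₂ s, f₃ s])
      (ContinuousLinearMap.pi ![d₀, d₁, d₂, d₃]) q := by
    rw [hasFDerivAt_pi]
    intro i
    fin_cases i <;> assumption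
  have h := (PiLp.continuousLinearEquiv 2 ℝ (fun _ : Fin 4 => ℝ)).symm.hasFDerivAt.comp q this
  intro v
  have h' : fderiv ℝ (fun s => (!₂[f₀ s, f₁ s, f₂ s, f₃ s] : E4)) q = _ := h.fderiv
  rw [h']
  ext i
  fin_cases i <;> rfl

theorem l_eq (a b x y : ℝ) : l a b x y = !₂[a * (Real.cos y / Real.cosh x),
    a * (Real.sin y / Real.cosh x), a * (Real.sinh x / Real.cosh x), b] := by
  have := (Real.cosh_pos x).ne'
  ext i
  fin_cases i <;> simp [l] <;> field_simp

theorem n_eq (a b x y : ℝ) : n a b x y = !₂[b * (Real.cos y / Real.cosh x),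
    b * (Real.sin y / Real.cosh x), b * (Real.sinh x / Real.cosh x), -a] := by
  have := (Real.cosh_pos x).ne'
  ext i
  fin_cases i <;> simp [n] <;> field_simp

/-- The derivative `∂l/∂x`. -/
def lx (a x y : ℝ) : E4 :=
  (a / Real.cosh x ^ 2) • !₂[-(Real.cos y * Real.sinh x), -(Real.sin y * Real.sinh x), 1, 0]

/-- The derivative `∂l/∂y`. -/
def ly (a x y : ℝ) : E4 :=
  (a / Real.cosh x) • !₂[-Real.sin y, Real.cos y, 0, 0]

theorem hasDerivAt_div_cosh (k x : ℝ) :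
    HasDerivAt (fun s => k / Real.cosh s) (-(k * Real.sinh x) / Real.cosh x ^ 2) x := by
  refine ((hasDerivAt_const x k).fun_div (Real.hasDerivAt_cosh x)
    (Real.cosh_pos x).ne').congr_deriv ?_
  ring

theorem hasDerivAt_sinh_div_cosh (x : ℝ) :
    HasDerivAt (fun s => Real.sinh s / Real.cosh s) (1 / Real.cosh x ^ 2) x := by
  refine ((Real.hasDerivAt_sinh x).fun_div (Real.hasDerivAt_cosh x)
    (Real.cosh_pos x).ne').congr_deriv ?_
  congr 1
  linear_combination Real.cosh_sq x

theorem hasDerivAt_l_x (a b x y : ℝ) : HasDerivAt (fun s => l a b s y) (lx a x y) x := by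
  simp only [l_eq]
  convert hasDerivAt_vec4 ((hasDerivAt_div_cosh (Real.cos y) x).const_mul a)
    ((hasDerivAt_div_cosh (Real.sin y) x).const_mul a)
    ((hasDerivAt_sinh_div_cosh x).const_mul a) (hasDerivAt_const x b) using 1
  ext i
  fin_cases i <;> simp [lx] <;> ring

theorem hasDerivAt_l_y (a b x y : ℝ) : HasDerivAt (fun s => l a b x s) (ly a x y) y := by
  simp only [l_eq]
  convert hasDerivAt_vec4 (((Real.hasDerivAt_cos y).div_const (Real.cosh x)).const_mul a)
    (((Real.hasDerivAt_sin y).div_const (Real.cosh x)).const_mul a)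
    (hasDerivAt_const y (a * (Real.sinh x / Real.cosh x))) (hasDerivAt_const y b) using 1
  ext i
  fin_cases i <;> simp [ly] <;> ring

theorem hasDerivAt_r_x (c : Fin 4 → ℝ) (x y : ℝ) : HasDerivAt (fun s => r c s y)
    ((c 3 - (c 1 * Real.cos y + c 2 * Real.sin y) * Real.sinh x) / Real.cosh x ^ 2) x := by
  have h : (fun s => r c s y) = fun s => c 0 + ((c 1 * Real.cos y + c 2 * Real.sin y) / Real.cosh s
      + c 3 * (Real.sinh s / Real.cosh s)) := by
    ext s
    simp only [r]
    ring
  rw [h]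
  refine (((hasDerivAt_div_cosh (c 1 * Real.cos y + c 2 * Real.sin y) x).fun_add
    ((hasDerivAt_sinh_div_cosh x).const_mul (c 3))).const_add (c 0)).congr_deriv ?_
  ring

theorem hasDerivAt_r_y (c : Fin 4 → ℝ) (x y : ℝ) : HasDerivAt (fun s => r c x s)
    ((c 2 * Real.cos y - c 1 * Real.sin y) / Real.cosh x) y := by
  unfold r
  refine (((((Real.hasDerivAt_cos y).const_mul (c 1)).fun_add
    ((Real.hasDerivAt_sin y).const_mul (c 2))).add_const (c 3 * Real.sinh x)).const_mul
    (1 / Real.cosh x) |>.const_add (c 0)).congr_deriv ?_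
  ring

/-- The coefficient of `n` in the envelope after splitting off a constant vector. -/
def height (a b : ℝ) (c : Fin 4 → ℝ) (x y w : ℝ) : ℝ :=
  w - b / (a * Real.cosh x) * (c 1 * Real.cos y + c 2 * Real.sin y + c 3 * Real.sinh x)

/-- With v = (c₁, c₂, c₃, 0)/a one has r = c₀ + ⟨v, l⟩. The sphere metric is (a/cosh x)² times the
flat one, so the derivative terms of the envelope form the component of v tangent to the sphere.
They sum with ⟨v, l⟩ l to v - ⟨v, n⟩ n, and `height` is w - ⟨v, n⟩. -/
theorem envelope_eq {a b : ℝ} (c : Fin 4 → ℝ) (ha : a ≠ 0) (hab : a ^ 2 + b ^ 2 = 1)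
    (x y w : ℝ) : envelope a b c x y w =
      !₂[c 1 / a, c 2 / a, c 3 / a, 0] + c 0 • l a b x y + height a b c x y w • n a b x y := by
  have hc := (Real.cosh_pos x).ne'
  have h1 := Real.cosh_sq x
  have h2 := Real.sin_sq_add_cos_sq y
  rw [envelope, (hasDerivAt_r_x c x y).deriv, (hasDerivAt_r_y c x y).deriv,
    (hasDerivAt_l_x a b x y).deriv, (hasDerivAt_l_y a b x y).deriv, l_eq, n_eq, lx, ly, r, height]
  generalize Real.cosh x = C at *
  generalize Real.sinh x = S at *
  generalize Real.cos y = u at *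
  generalize Real.sin y = v at *
  ext i
  fin_cases i
  · simp
    field_simp
    linear_combination (u * (c 1 * u + c 2 * v + c 3 * S)) * hab - u * (c 1 * u + c 2 * v) * h1 +
      c 1 * C ^ 2 * h2
  · simp
    field_simp
    linear_combination (v * (c 1 * u + c 2 * v + c 3 * S)) * hab - v * (c 1 * u + c 2 * v) * h1 +
      c 2 * C ^ 2 * h2
  · simp
    field_simp
    linear_combination (S * (c 1 * u + c 2 * v + c 3 * S)) * hab - c 3 * h1
  · simp
    field_simp
    ring

/-- From b l - a n = (0, 0, 0, 1), division by b turns c₀ l into (a/b) c₀ n plus the last entry c₀/b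
of `C`. -/
theorem envelope_eq_smul_add {a b : ℝ} (c : Fin 4 → ℝ) (ha : a ≠ 0) (hab : a ^ 2 + b ^ 2 = 1)
    (hb : b ≠ 0) (x y w : ℝ) :
    envelope a b c x y w = f a b c x y w • n a b x y + C a b c := by
  have hc := (Real.cosh_pos x).ne'
  rw [envelope_eq c ha hab, l_eq, n_eq]
  ext i
  fin_cases i
  · simp [f, height, C]
    field_simp
    ring
  · simp [f, height, C]
    field_simp
    ring
  · simp [f, height, C]
    field_simp
    ring
  · simp [f, height, C]
    field_simp
    linear_combination (c 0 * Real.cosh x) * hab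

theorem envelope_one_zero (c : Fin 4 → ℝ) (x y w : ℝ) :
    envelope 1 0 c x y w =
      !₂[c 0 * (Real.cos y / Real.cosh x) + c 1, c 0 * (Real.sin y / Real.cosh x) + c 2,
        c 0 * (Real.sinh x / Real.cosh x) + c 3, -w] := by
  rw [envelope_eq c one_ne_zero (by norm_num), l_eq, n_eq]
  ext i
  fin_cases i <;> simp [height] <;> ring

/-! ### Normal projection, second fundamental form and Gauss equation. -/

theorem fderiv_fderiv_apply {E G : Type*} [NormedAddCommGroup E] [NormedSpace ℝ E]
    [NormedAddCommGroup G] [NormedSpace ℝ G] {f : E → G} {q : E} (hf : ContDiffAt ℝ 2 f q)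
    (v w : E) :
    fderiv ℝ (fun s => fderiv ℝ f s v) q w = fderiv ℝ (fderiv ℝ f) q w v := by
  have h : DifferentiableAt ℝ (fderiv ℝ f) q :=
    (hf.fderiv_right (m := 1) (by norm_num)).differentiableAt (by norm_num)
  simp [fderiv_clm_apply h (differentiableAt_const v)]

theorem fderiv_fderiv_apply_comm {E G : Type*} [NormedAddCommGroup E] [NormedSpace ℝ E]
    [NormedAddCommGroup G] [NormedSpace ℝ G] {f : E → G} {q : E} (hf : ContDiffAt ℝ 2 f q)
    (v w : E) :
    fderiv ℝ (fun s => fderiv ℝ f s v) q w = fderiv ℝ (fun s => fderiv ℝ f s w) q v := by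
  rw [fderiv_fderiv_apply hf, fderiv_fderiv_apply hf]
  exact (hf.isSymmSndFDerivAt (by simp)).eq w v

theorem fderiv_apply_mem (F : E3 → E4) (q v : E3) : fderiv ℝ F q v ∈ tangentSpaceAt F q :=
  ⟨v, rfl⟩

theorem orthogonal_tangentSpaceAt {F : E3 → E4} {q : E3} {N : E4}
    (hF : Function.Injective (fderiv ℝ F q)) (hN : IsUnitNormalAt F q N) :
    (tangentSpaceAt F q)ᗮ = Submodule.span ℝ {N} := by
  have h3 : Module.finrank ℝ (tangentSpaceAt F q) = 3 := by
    rw [tangentSpaceAt, LinearMap.finrank_range_of_inj hF]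
    simp
  have h4 := Submodule.finrank_add_finrank_orthogonal (tangentSpaceAt F q)
  have hN0 : N ≠ 0 := by
    rintro rfl
    simpa using hN.1
  symm
  apply Submodule.eq_of_le_of_finrank_eq
  · simpa using hN.2
  · rw [finrank_span_singleton hN0]
    simp at h4
    omega

theorem starProjection_tangentSpaceAt {F : E3 → E4} {q : E3} {N : E4}
    (hF : Function.Injective (fderiv ℝ F q)) (hN : IsUnitNormalAt F q N) (x : E4) :
    (tangentSpaceAt F q).starProjection x = x - ⟪N, x⟫ • N := by
  have h := Submodule.starProjection_unit_singleton ℝ hN.1 x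
  rw [← h]
  simp only [← orthogonal_tangentSpaceAt hF hN]
  simp [Submodule.starProjection_orthogonal]

theorem mem_tangentSpaceAt_iff {F : E3 → E4} {q : E3} {N : E4}
    (hF : Function.Injective (fderiv ℝ F q)) (hN : IsUnitNormalAt F q N) (x : E4) :
    x ∈ tangentSpaceAt F q ↔ ⟪N, x⟫ = 0 := by
  have hN0 : N ≠ 0 := by
    rintro rfl
    simpa using hN.1
  rw [← Submodule.starProjection_eq_self_iff, starProjection_tangentSpaceAt hF hN]
  simp [hN0]

theorem fderiv_inner_self_eq_zero {N : E3 → E4} {q : E3} (hN : DifferentiableAt ℝ N q)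
    (h : ∀ᶠ s in 𝓝 q, ‖N s‖ = 1) (v : E3) : ⟪N q, fderiv ℝ N q v⟫ = 0 := by
  have h1 : (fun s => ⟪N s, N s⟫) =ᶠ[𝓝 q] fun _ => (1 : ℝ) := by
    filter_upwards [h] with s hs
    simp [hs]
  have h2 := congrArg (fun L : E3 →L[ℝ] ℝ => L v) h1.fderiv_eq
  simp only [fderiv_inner_apply ℝ hN hN, fderiv_fun_const] at h2
  simp only [real_inner_comm (N q)] at h2 ⊢
  simpa using h2

theorem secondFundamentalForm_eq {F N : E3 → E4} {q : E3} (hF : ContDiffAt ℝ 2 F q)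
    (hN : DifferentiableAt ℝ N q) (h : ∀ᶠ s in 𝓝 q, N s ∈ (tangentSpaceAt F s)ᗮ) (v w : E3) :
    secondFundamentalForm F q (N q) v w = -⟪fderiv ℝ F q v, fderiv ℝ N q w⟫ := by
  have h1 : (fun s => ⟪fderiv ℝ F s v, N s⟫) =ᶠ[𝓝 q] fun _ => (0 : ℝ) := by
    filter_upwards [h] with s hs
    exact hs _ (fderiv_apply_mem F s v)
  have hd : DifferentiableAt ℝ (fun s => fderiv ℝ F s v) q :=
    ((hF.fderiv_right (m := 1) (by norm_num)).differentiableAt (by norm_num)).clm_apply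
      (differentiableAt_const v)
  have h2 := congrArg (fun L : E3 →L[ℝ] ℝ => L w) h1.fderiv_eq
  simp only [fderiv_inner_apply ℝ hd hN, fderiv_fun_const] at h2
  rw [secondFundamentalForm]
  have h3 : (0 : E3 → E3 →L[ℝ] ℝ) q w = 0 := rfl
  linarith

/-- Gauss equation. The inner covariant derivative is a second derivative of F minus its normal
part, a multiple of `N`. After one more derivative and projection, `N` disappears and dN, already
tangent, survives; the third derivatives of F cancel by symmetry. -/
theorem curvature_eq {F N : E3 → E4} {q : E3} (hF : ContDiffAt ℝ 3 F q)
    (hN : DifferentiableAt ℝ N q) (hi : ∀ᶠ s in 𝓝 q, Function.Injective (fderiv ℝ F s))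
    (h : ∀ᶠ s in 𝓝 q, IsUnitNormalAt F s (N s)) (v w z : E3) :
    curvature F q v w z = secondFundamentalForm F q (N q) z v • fderiv ℝ N q w -
      secondFundamentalForm F q (N q) z w • fderiv ℝ N q v := by
  have hZ : ContDiffAt ℝ 2 (fun s => fderiv ℝ F s z) q :=
    (hF.fderiv_right (m := 2) (by norm_num)).clm_apply contDiffAt_const
  have hq := hi.self_of_nhds
  have hNq := h.self_of_nhds
  have key : ∀ v w : E3, covDeriv F v (covDeriv F w (fun s => fderiv ℝ F s z)) q =
      (tangentSpaceAt F q).starProjection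
        (fderiv ℝ (fun s => fderiv ℝ (fun s => fderiv ℝ F s z) s w) q v) -
      secondFundamentalForm F q (N q) z w • fderiv ℝ N q v := by
    intro v w
    have h1 : covDeriv F w (fun s => fderiv ℝ F s z) =ᶠ[𝓝 q] fun s =>
        fderiv ℝ (fun s => fderiv ℝ F s z) s w -
          ⟪N s, fderiv ℝ (fun s => fderiv ℝ F s z) s w⟫ • N s := by
      filter_upwards [hi, h] with s h1 h2
      rw [covDeriv, starProjection_tangentSpaceAt h1 h2]
    have hG : DifferentiableAt ℝ (fun s => fderiv ℝ (fun s => fderiv ℝ F s z) s w) q :=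
      ((hZ.fderiv_right (m := 1) (by norm_num)).differentiableAt (by norm_num)).clm_apply
        (differentiableAt_const w)
    have hI := hN.inner ℝ hG
    rw [covDeriv, h1.fderiv_eq, fderiv_fun_sub hG (hI.fun_smul hN), fderiv_fun_smul hI hN]
    simp only [sub_apply, add_apply,
      smul_apply, ContinuousLinearMap.smulRight_apply, map_sub, map_add,
      map_smul]
    have e1 : (tangentSpaceAt F q).starProjection (N q) = 0 := by
      rw [starProjection_tangentSpaceAt hq hNq, real_inner_self_eq_norm_sq, hNq.1]
      simp
    have e2 : (tangentSpaceAt F q).starProjection (fderiv ℝ N q v) = fderiv ℝ N q v := by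
      rw [starProjection_tangentSpaceAt hq hNq,
        fderiv_inner_self_eq_zero hN (h.mono fun s hs => hs.1)]
      simp
    rw [e1, e2, secondFundamentalForm, real_inner_comm (N q)]
    simp
  rw [curvature, key, key, fderiv_fderiv_apply_comm hZ]
  abel

theorem eventually_injective_fderiv {F : E3 → E4} {q : E3} (hF : ContDiffAt ℝ 1 F q)
    (hi : Function.Injective (fderiv ℝ F q)) :
    ∀ᶠ s in 𝓝 q, Function.Injective (fderiv ℝ F s) := by
  have hc : ContinuousAt (fderiv ℝ F) q :=
    (hF.fderiv_right (m := 0) (by norm_num)).continuousAt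
  exact hc.eventually (ContinuousLinearMap.isOpen_injective.mem_nhds hi)

/-! ### The converse: geometry of the envelopes at regular points. -/

theorem hasFDerivAt_coord (i : Fin 3) (q : E3) :
    HasFDerivAt (fun s : E3 => s i) (EuclideanSpace.proj i : E3 →L[ℝ] ℝ) q :=
  (EuclideanSpace.proj i : E3 →L[ℝ] ℝ).hasFDerivAt

theorem contDiff_coord (i : Fin 3) : ContDiff ℝ ∞ (fun s : E3 => s i) :=
  (EuclideanSpace.proj i : E3 →L[ℝ] ℝ).contDiff

theorem contDiff_l (a b : ℝ) : ContDiff ℝ ∞ (fun s : E3 => l a b (s 0) (s 1)) := by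
  simp only [l_eq]
  have h : ∀ s : E3, Real.cosh (s 0) ≠ 0 := fun s => (Real.cosh_pos _).ne'
  have h0 := contDiff_coord 0
  have h1 := contDiff_coord 1
  rw [contDiff_euclidean]
  intro i
  fin_cases i
  · exact contDiff_const.mul ((Real.contDiff_cos.comp h1).div (Real.contDiff_cosh.comp h0) h)
  · exact contDiff_const.mul ((Real.contDiff_sin.comp h1).div (Real.contDiff_cosh.comp h0) h)
  · exact contDiff_const.mul ((Real.contDiff_sinh.comp h0).div (Real.contDiff_cosh.comp h0) h)
  · exact contDiff_const

theorem contDiff_height {a : ℝ} (ha : a ≠ 0) (b : ℝ) (c : Fin 4 → ℝ) :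
    ContDiff ℝ ∞ (fun s : E3 => height a b c (s 0) (s 1) (s 2)) := by
  have h : ∀ s : E3, a * Real.cosh (s 0) ≠ 0 := fun s => mul_ne_zero ha (Real.cosh_pos _).ne'
  have h0 := contDiff_coord 0
  have h1 := contDiff_coord 1
  have h2 := contDiff_coord 2
  have hch := Real.contDiff_cosh.comp h0 (n := ∞)
  have hsh := Real.contDiff_sinh.comp h0 (n := ∞)
  exact h2.sub ((contDiff_const.div (contDiff_const.mul hch) h).mul
    (((contDiff_const.mul (Real.contDiff_cos.comp h1)).add
      (contDiff_const.mul (Real.contDiff_sin.comp h1))).add (contDiff_const.mul hsh)))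

theorem hasFDerivAt_comp_div_cosh {g : ℝ → ℝ} {d : ℝ} {q : E3} (hg : HasDerivAt g d (q 1)) :
    HasFDerivAt (fun s : E3 => g (s 1) / Real.cosh (s 0))
      ((d / Real.cosh (q 0)) • (EuclideanSpace.proj 1 : E3 →L[ℝ] ℝ) -
        (g (q 1) * Real.sinh (q 0) / Real.cosh (q 0) ^ 2) • EuclideanSpace.proj 0) q := by
  have h := (hg.comp_hasFDerivAt q (hasFDerivAt_coord 1 q)).fun_mul
    ((hasDerivAt_div_cosh 1 (q 0)).comp_hasFDerivAt q (hasFDerivAt_coord 0 q))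
  refine (h.congr_of_eventuallyEq
    (Eventually.of_forall fun s => by simp [div_eq_mul_inv])).congr_fderiv ?_
  ext v
  simp
  ring

theorem fderiv_l (a b : ℝ) (q v : E3) : fderiv ℝ (fun s : E3 => l a b (s 0) (s 1)) q v =
    v 0 • lx a (q 0) (q 1) + v 1 • ly a (q 0) (q 1) := by
  simp only [l_eq]
  have h0 := hasFDerivAt_coord 0 q
  have hc : Real.cosh (q 0) ≠ 0 := (Real.cosh_pos _).ne'
  have h := fderiv_vec4
    ((hasFDerivAt_comp_div_cosh (Real.hasDerivAt_cos (q 1))).const_mul a)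
    ((hasFDerivAt_comp_div_cosh (Real.hasDerivAt_sin (q 1))).const_mul a)
    ((((hasDerivAt_sinh_div_cosh (q 0))).comp_hasFDerivAt q h0).const_mul a)
    (hasFDerivAt_const b q)
  refine (h v).trans ?_
  ext i
  fin_cases i <;> simp [lx, ly] <;> field_simp <;> ring

theorem norm_l {a b : ℝ} (hab : a ^ 2 + b ^ 2 = 1) (x y : ℝ) : ‖l a b x y‖ = 1 := by
  have hc : Real.cosh x ≠ 0 := (Real.cosh_pos _).ne'
  rw [← sq_eq_sq₀ (norm_nonneg _) zero_le_one, EuclideanSpace.norm_sq_eq, l_eq]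
  simp [Fin.sum_univ_four]
  field_simp
  linear_combination (Real.cosh x ^ 2) * hab - a ^ 2 * Real.cosh_sq x +
    a ^ 2 * Real.sin_sq_add_cos_sq y

theorem inner_l_n {a b : ℝ} (x y : ℝ) : ⟪l a b x y, n a b x y⟫ = 0 := by
  have hc : Real.cosh x ≠ 0 := (Real.cosh_pos _).ne'
  simp [l_eq, n_eq, PiLp.inner_apply, Fin.sum_univ_four]
  field_simp
  linear_combination (-a * b) * Real.cosh_sq x + a * b * Real.sin_sq_add_cos_sq y

theorem inner_lx_n (a b x y : ℝ) : ⟪lx a x y, n a b x y⟫ = 0 := by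
  have hc : Real.cosh x ≠ 0 := (Real.cosh_pos _).ne'
  simp [lx, n_eq, PiLp.inner_apply, Fin.sum_univ_four]
  field_simp
  linear_combination -(a * b * Real.sinh x) * Real.sin_sq_add_cos_sq y

theorem inner_ly_n (a b x y : ℝ) : ⟪ly a x y, n a b x y⟫ = 0 := by
  have hc : Real.cosh x ≠ 0 := (Real.cosh_pos _).ne'
  simp [ly, n_eq, PiLp.inner_apply, Fin.sum_univ_four]
  field_simp
  ring

theorem inner_lx_ly (a x y : ℝ) : ⟪lx a x y, ly a x y⟫ = 0 := by
  simp [lx, ly, PiLp.inner_apply, Fin.sum_univ_four]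
  ring

theorem inner_lx_lx (a x y : ℝ) : ⟪lx a x y, lx a x y⟫ = (a / Real.cosh x) ^ 2 := by
  have hc : Real.cosh x ≠ 0 := (Real.cosh_pos _).ne'
  rw [real_inner_self_eq_norm_sq, EuclideanSpace.norm_sq_eq]
  simp [lx, Fin.sum_univ_four]
  field_simp
  simp only [sq_abs]
  linear_combination a ^ 2 * Real.sinh x ^ 2 * Real.sin_sq_add_cos_sq y - a ^ 2 * Real.cosh_sq x

theorem inner_ly_ly (a x y : ℝ) : ⟪ly a x y, ly a x y⟫ = (a / Real.cosh x) ^ 2 := by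
  have hc : Real.cosh x ≠ 0 := (Real.cosh_pos _).ne'
  rw [real_inner_self_eq_norm_sq, EuclideanSpace.norm_sq_eq]
  simp [ly, Fin.sum_univ_four]
  field_simp
  simp only [sq_abs]
  linear_combination a ^ 2 * Real.cosh x ^ 2 * Real.sin_sq_add_cos_sq y

theorem n_eq_sub {a b : ℝ} (ha : a ≠ 0) (hab : a ^ 2 + b ^ 2 = 1) (x y : ℝ) :
    n a b x y = (b / a) • l a b x y - (!₂[0, 0, 0, 1 / a] : E4) := by
  rw [n_eq, l_eq]
  ext i
  fin_cases i
  · simp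
    field_simp
  · simp
    field_simp
  · simp
    field_simp
  · simp
    field_simp
    linear_combination -hab

theorem envelope_fun_eq {a b : ℝ} (c : Fin 4 → ℝ) (ha : a ≠ 0) (hab : a ^ 2 + b ^ 2 = 1) :
    (fun s : E3 => envelope a b c (s 0) (s 1) (s 2)) = fun s =>
      !₂[c 1 / a, c 2 / a, c 3 / a, 0] + (c 0 • l a b (s 0) (s 1) +
        height a b c (s 0) (s 1) (s 2) •
          ((b / a) • l a b (s 0) (s 1) - (!₂[0, 0, 0, 1 / a] : E4))) := by
  ext1 s
  rw [envelope_eq c ha hab, n_eq_sub ha hab]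
  abel

theorem contDiff_envelope {a b : ℝ} (c : Fin 4 → ℝ) (ha : a ≠ 0) (hab : a ^ 2 + b ^ 2 = 1) :
    ContDiff ℝ ∞ (fun s : E3 => envelope a b c (s 0) (s 1) (s 2)) := by
  rw [envelope_fun_eq c ha hab]
  have hl := contDiff_l a b
  have hh := contDiff_height ha b c
  fun_prop

theorem fderiv_envelope {a b : ℝ} (c : Fin 4 → ℝ) (ha : a ≠ 0) (hab : a ^ 2 + b ^ 2 = 1)
    (q v : E3) : fderiv ℝ (fun s : E3 => envelope a b c (s 0) (s 1) (s 2)) q v =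
      (c 0 + height a b c (q 0) (q 1) (q 2) * (b / a)) •
        fderiv ℝ (fun s : E3 => l a b (s 0) (s 1)) q v +
      fderiv ℝ (fun s : E3 => height a b c (s 0) (s 1) (s 2)) q v • n a b (q 0) (q 1) := by
  have hl : DifferentiableAt ℝ (fun s : E3 => l a b (s 0) (s 1)) q :=
    (contDiff_l a b).differentiable (by simp) q
  have hh : DifferentiableAt ℝ (fun s : E3 => height a b c (s 0) (s 1) (s 2)) q :=
    (contDiff_height ha b c).differentiable (by simp) q
  have h := ((hl.hasFDerivAt.const_smul (c 0)).fun_add (hh.hasFDerivAt.fun_smul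
    ((hl.hasFDerivAt.const_smul (b / a)).sub_const (!₂[0, 0, 0, 1 / a] : E4)))).const_add
      (!₂[c 1 / a, c 2 / a, c 3 / a, 0] : E4)
  rw [envelope_fun_eq c ha hab, n_eq_sub ha hab]
  have h' := congrArg (fun L : E3 →L[ℝ] E4 => L v) h.fderiv
  refine h'.trans ?_
  simp
  module

/-- The unit normal is `l`, which does not depend on w. Since dY = ρ dl + dh · n, where h is the
height and dl has orthogonal partial derivatives of equal length, the shape operator is -1/ρ on the
span of these and 0 on `n`. -/
theorem isBiUmbilicalFoliatedAt_envelope {a b : ℝ} (c : Fin 4 → ℝ) (ha : 0 < a)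
    (hab : a ^ 2 + b ^ 2 = 1) (q : E3)
    (hi : Function.Injective
      (fderiv ℝ (fun s : E3 => envelope a b c (s 0) (s 1) (s 2)) q)) :
    IsBiUmbilicalFoliatedAt (fun s : E3 => envelope a b c (s 0) (s 1) (s 2)) q := by
  set F : E3 → E4 := fun s => envelope a b c (s 0) (s 1) (s 2) with hFdef
  set N : E3 → E4 := fun s => l a b (s 0) (s 1) with hNdef
  set p : ℝ := a / Real.cosh (q 0) with hp
  have hp0 : p ≠ 0 := (div_pos ha (Real.cosh_pos _)).ne'
  set X := lx a (q 0) (q 1) with hX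
  set Y := ly a (q 0) (q 1) with hY
  have hXX : ⟪X, X⟫ = p ^ 2 := inner_lx_lx _ _ _
  have hYY : ⟪Y, Y⟫ = p ^ 2 := inner_ly_ly _ _ _
  have hXY : ⟪X, Y⟫ = 0 := inner_lx_ly _ _ _
  have hYX : ⟪Y, X⟫ = 0 := by rw [real_inner_comm, hXY]
  have hX0 : X ≠ 0 := fun h => hp0 (by simpa [h] using hXX.symm)
  have hY0 : Y ≠ 0 := fun h => hp0 (by simpa [h] using hYY.symm)
  have hdN : ∀ v, fderiv ℝ N q v = v 0 • X + v 1 • Y := fderiv_l a b q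
  have hF : ContDiff ℝ ∞ F := contDiff_envelope c ha.ne' hab
  have hN : ContDiff ℝ ∞ N := contDiff_l a b
  have hNu : ∀ s, IsUnitNormalAt F s (N s) := by
    intro s
    refine ⟨norm_l hab _ _, ?_⟩
    rintro _ ⟨v, rfl⟩
    have h1 := fderiv_inner_self_eq_zero (hN.differentiable (by simp) s)
      (Eventually.of_forall fun s => norm_l hab (s 0) (s 1)) v
    have h2 : ⟪l a b (s 0) (s 1), n a b (s 0) (s 1)⟫ = 0 := inner_l_n _ _
    simp only [ContinuousLinearMap.coe_coe, hFdef, fderiv_envelope c ha.ne' hab, inner_add_left,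
      inner_smul_left]
    rw [real_inner_comm, real_inner_comm (N s)]
    simp only [hNdef] at h1 ⊢
    rw [h1, h2]
    simp
  set ρ : ℝ := c 0 + height a b c (q 0) (q 1) (q 2) * (b / a) with hρ
  set H : E3 →L[ℝ] ℝ := fderiv ℝ (fun s : E3 => height a b c (s 0) (s 1) (s 2)) q
  have hdF : ∀ v, fderiv ℝ F q v = ρ • (v 0 • X + v 1 • Y) + H v • n a b (q 0) (q 1) := by
    intro v
    rw [← hdN]
    exact fderiv_envelope c ha.ne' hab q v
  have hXn : ⟪X, n a b (q 0) (q 1)⟫ = 0 := inner_lx_n _ _ _ _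
  have hYn : ⟪Y, n a b (q 0) (q 1)⟫ = 0 := inner_ly_n _ _ _ _
  have hII : ∀ v w, secondFundamentalForm F q (N q) v w =
      -(ρ * p ^ 2) * (v 0 * w 0 + v 1 * w 1) := by
    intro v w
    rw [secondFundamentalForm_eq (hF.contDiffAt.of_le (by norm_cast))
      (hN.differentiable (by simp) q) (Eventually.of_forall fun s => (hNu s).2), hdF, hdN]
    simp only [inner_add_left, inner_add_right, real_inner_smul_left, real_inner_smul_right,
      hXX, hYY, hXY, hYX]
    rw [real_inner_comm, hXn, real_inner_comm, hYn]
    ring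
  have hNX : ⟪N q, X⟫ = 0 := by
    have h := fderiv_inner_self_eq_zero (hN.differentiable (by simp) q)
      (Eventually.of_forall fun s => (hNu s).1) (EuclideanSpace.single 0 1)
    rw [hdN] at h
    simpa using h
  have hNY : ⟪N q, Y⟫ = 0 := by
    have h := fderiv_inner_self_eq_zero (hN.differentiable (by simp) q)
      (Eventually.of_forall fun s => (hNu s).1) (EuclideanSpace.single 1 1)
    rw [hdN] at h
    simpa using h
  -- If ρ vanished, the differential would have its image in the line of `n`, contradicting
  -- injectivity.
  have hρ0 : ρ ≠ 0 := by
    intro h0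
    rw [h0] at hdF
    have h1 : LinearMap.range (fderiv ℝ F q : E3 →ₗ[ℝ] E4) ≤
        Submodule.span ℝ {n a b (q 0) (q 1)} := by
      rintro _ ⟨v, rfl⟩
      rw [ContinuousLinearMap.coe_coe, hdF, zero_smul, zero_add]
      exact Submodule.smul_mem _ _ (Submodule.mem_span_singleton_self _)
    have h2 := (Submodule.finrank_mono h1).trans (finrank_span_le_card _)
    rw [LinearMap.finrank_range_of_inj hi] at h2
    simp at h2
  have hR : ∀ v w z, curvature F q v w z =
      -(ρ * p ^ 2) • ((z 0 * v 0 + z 1 * v 1) • (w 0 • X + w 1 • Y) -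
        (z 0 * w 0 + z 1 * w 1) • (v 0 • X + v 1 • Y)) := by
    intro v w z
    rw [curvature_eq (hF.contDiffAt.of_le (by norm_cast))
      (hN.differentiable (by simp) q)
      (eventually_injective_fderiv (hF.contDiffAt.of_le (by norm_cast)) hi)
      (Eventually.of_forall hNu), hII, hII, hdN, hdN]
    module
  constructor
  · refine ⟨Submodule.span ℝ {EuclideanSpace.single 2 1}, ?_, fun v => ?_⟩
    · rw [finrank_span_singleton]
      intro h
      simpa using congrArg (fun u : E3 => u 2) h
    · rw [Submodule.mem_span_singleton]
      constructor
      · rintro ⟨t, rfl⟩ w z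
        rw [hR]
        simp
      · intro h
        -- R(v, ∂ₓ)∂ₓ is a nonzero multiple of v₁ Y and R(v, ∂ᵧ)∂ᵧ one of v₀ X, so nullity kills
        -- both coordinates.
        have h0 := congrArg (fun u => ⟪Y, u⟫) (h (EuclideanSpace.single 0 1)
          (EuclideanSpace.single 0 1))
        have h1 := congrArg (fun u => ⟪X, u⟫) (h (EuclideanSpace.single 1 1)
          (EuclideanSpace.single 1 1))
        simp [hR, real_inner_smul_right,
          hρ0, hp0, hX0, hY0] at h0 h1
        refine ⟨v 2, ?_⟩
        ext i
        fin_cases i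
        · simp [h1]
        · simp [h0]
        · simp
  · refine ⟨N q, hNu q, -(1 / ρ), by simpa using hρ0, p⁻¹ • X, ?_, p⁻¹ • Y, ?_, ?_, ?_, ?_, ?_⟩
    · exact Submodule.smul_mem _ _ ((mem_tangentSpaceAt_iff hi (hNu q) X).2 hNX)
    · exact Submodule.smul_mem _ _ ((mem_tangentSpaceAt_iff hi (hNu q) Y).2 hNY)
    · rw [← sq_eq_sq₀ (norm_nonneg _) zero_le_one, ← real_inner_self_eq_norm_sq,
        real_inner_smul_left, real_inner_smul_right, hXX]
      field_simp
    · rw [← sq_eq_sq₀ (norm_nonneg _) zero_le_one, ← real_inner_self_eq_norm_sq,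
        real_inner_smul_left, real_inner_smul_right, hYY]
      field_simp
    · rw [real_inner_smul_left, real_inner_smul_right, hXY]
      simp
    · intro v w
      rw [hII, hdF, hdF]
      simp only [inner_add_right, real_inner_smul_left, real_inner_smul_right, hXX, hYY, hXY, hYX,
        hXn, hYn]
      field_simp
      ring

/-! ### Smooth local frames adapted to the shape operator. -/

/-- Border dF with a fixed vector `N₀` normal at `q₀`: the resulting map E3 × ℝ → E4 is invertible
near `q₀`, and its inverse depends smoothly on the point. The ℝ-component of the inverse vanishes on
tangent vectors, so its Riesz vector, normalised, is `N`; the E3-component is the left inverse `J`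
of dF. -/
theorem exists_smooth_unitNormal {F : E3 → E4} {q₀ : E3}
    (hF : ∀ᶠ s in 𝓝 q₀, ContDiffAt ℝ ∞ F s) (hi : Function.Injective (fderiv ℝ F q₀)) :
    ∃ (N : E3 → E4) (J : E3 → E4 →L[ℝ] E3), ∀ᶠ s in 𝓝 q₀, ContDiffAt ℝ ∞ N s ∧
      ContDiffAt ℝ ∞ J s ∧ IsUnitNormalAt F s (N s) ∧ ∀ v, J s (fderiv ℝ F s v) = v := by
  obtain ⟨N₀, hN₀, hN₀'⟩ : ∃ N₀ ∈ (tangentSpaceAt F q₀)ᗮ, N₀ ≠ 0 := by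
    refine Submodule.exists_mem_ne_zero_of_ne_bot fun h => ?_
    have h4 := Submodule.finrank_add_finrank_orthogonal (tangentSpaceAt F q₀)
    have h3 : Module.finrank ℝ (tangentSpaceAt F q₀) = 3 := by
      rw [tangentSpaceAt, LinearMap.finrank_range_of_inj hi]
      simp
    rw [h, h3] at h4
    simp at h4
  set A : E3 → (E3 × ℝ →L[ℝ] E4) := fun s =>
    (fderiv ℝ F s) ∘L (ContinuousLinearMap.fst ℝ E3 ℝ) +
      (ContinuousLinearMap.toSpanSingleton ℝ N₀) ∘L (ContinuousLinearMap.snd ℝ E3 ℝ) with hA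
  have hAs : ∀ᶠ s in 𝓝 q₀, ContDiffAt ℝ ∞ A s := by
    filter_upwards [hF] with s hs
    exact ((hs.fderiv_right (m := ∞) (by norm_cast)).clm_comp contDiffAt_const).add
      contDiffAt_const
  have hAapp : ∀ s v t, A s (v, t) = fderiv ℝ F s v + t • N₀ := fun s v t => by simp [hA]
  have hA0 : Function.Injective (A q₀) := by
    rw [injective_iff_map_eq_zero]
    rintro ⟨v, t⟩ h
    rw [hAapp] at h
    have h1 : ⟪fderiv ℝ F q₀ v, N₀⟫ = 0 := hN₀ _ (fderiv_apply_mem F q₀ v)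
    have h2 := congrArg (fun u => ⟪u, N₀⟫) h
    simp only [inner_add_left, h1, real_inner_smul_left, inner_zero_left, zero_add,
      mul_eq_zero, inner_self_eq_zero, hN₀', or_false] at h2
    rw [h2, zero_smul, add_zero] at h
    have h3 := (injective_iff_map_eq_zero _).1 hi v h
    rw [h2, h3]
    rfl
  have hdim : Module.finrank ℝ (E3 × ℝ) = Module.finrank ℝ E4 := by simp
  have hinv : ∀ s, Function.Injective (A s) → (A s).IsInvertible := fun s hs =>
    ⟨(LinearEquiv.ofInjectiveOfFinrankEq (A s : E3 × ℝ →ₗ[ℝ] E4) hs hdim).toContinuousLinearEquiv,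
      by ext <;> rfl⟩
  have hinj : ∀ᶠ s in 𝓝 q₀, Function.Injective (A s) :=
    hAs.self_of_nhds.continuousAt.eventually (ContinuousLinearMap.isOpen_injective.mem_nhds hA0)
  set K : E3 → (E4 →L[ℝ] E3 × ℝ) := fun s => (A s).inverse with hK
  set lam : E3 → (E4 →L[ℝ] ℝ) := fun s => (ContinuousLinearMap.snd ℝ E3 ℝ) ∘L K s with hlam
  set n₀ : E3 → E4 := fun s => WithLp.toLp 2 fun i => lam s (EuclideanSpace.single i 1) with hn₀
  have hn₀x : ∀ s x, ⟪n₀ s, x⟫ = lam s x := by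
    intro s x
    have hx : x = ∑ i, x i • EuclideanSpace.single i (1 : ℝ) := by
      ext i
      fin_cases i <;> simp [Fin.sum_univ_four]
    conv_rhs => rw [hx]
    simp [hn₀, PiLp.inner_apply]
  refine ⟨fun s => ‖n₀ s‖⁻¹ • n₀ s, fun s => (ContinuousLinearMap.fst ℝ E3 ℝ) ∘L K s, ?_⟩
  filter_upwards [hAs, hinj] with s hs his
  have hKA : ∀ z, K s (A s z) = z := by
    intro z
    obtain ⟨e, he⟩ := hinv s his
    simp [hK, ← he]
  have hKs : ContDiffAt ℝ ∞ K s := (hinv s his).contDiffAt_map_inverse.comp s hs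
  have hls : ContDiffAt ℝ ∞ lam s := contDiffAt_const.clm_comp hKs
  have hns : ContDiffAt ℝ ∞ n₀ s := by
    rw [contDiffAt_euclidean]
    intro i
    exact hls.clm_apply contDiffAt_const
  have hne : n₀ s ≠ 0 := by
    intro h
    have h1 : lam s (A s (0, 1)) = 1 := by simp [hlam, hKA]
    rw [← hn₀x, h] at h1
    simp at h1
  refine ⟨((hns.norm ℝ hne).inv (norm_ne_zero_iff.2 hne)).smul hns,
    contDiffAt_const.clm_comp hKs, ⟨by simp [norm_smul, hne], ?_⟩, fun v => ?_⟩
  · rintro _ ⟨v, rfl⟩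
    have h1 : lam s (A s (v, 0)) = 0 := by simp [hlam, hKA]
    rw [hAapp, zero_smul, add_zero, ← hn₀x] at h1
    rw [real_inner_smul_right, real_inner_comm]
    simp [h1]
  · have := hKA (v, 0)
    rw [hAapp, zero_smul, add_zero] at this
    simp [this]

theorem exists_orthonormalBasis_three {u₀ u₁ u₂ : E4} (h₀ : ‖u₀‖ = 1) (h₁ : ‖u₁‖ = 1)
    (h₂ : ‖u₂‖ = 1) (h₀₁ : ⟪u₀, u₁⟫ = 0) (h₀₂ : ⟪u₀, u₂⟫ = 0) (h₁₂ : ⟪u₁, u₂⟫ = 0) :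
    ∃ B : OrthonormalBasis (Fin 4) ℝ E4, B 0 = u₀ ∧ B 1 = u₁ ∧ B 2 = u₂ := by
  have h : Orthonormal ℝ (({0, 1, 2} : Set (Fin 4)).domRestrict ![u₀, u₁, u₂, 0]) := by
    rw [orthonormal_iff_ite]
    have h₁₀ := real_inner_comm u₀ u₁
    have h₂₀ := real_inner_comm u₀ u₂
    have h₂₁ := real_inner_comm u₁ u₂
    rintro ⟨i, hi⟩ ⟨j, hj⟩
    simp only [Set.mem_insert_iff, Set.mem_singleton_iff] at hi hj
    rcases hi with rfl | rfl | rfl <;> rcases hj with rfl | rfl | rfl <;>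
      simp [Set.domRestrict_apply, h₀, h₁, h₂, h₀₁, h₀₂, h₁₂, h₁₀, h₂₀, h₂₁]
  obtain ⟨B, hB⟩ := h.exists_orthonormalBasis_extension_of_card_eq (by simp)
  exact ⟨B, by simpa using hB 0, by simpa using hB 1, by simpa using hB 2⟩

/-- The kernel direction is the fourth vector of an orthonormal basis extending e₁, e₂, `N`. The
given normal may be -`N`, hence the factor `t⁻¹` in the curvature. -/
theorem exists_kernel_direction {F N : E3 → E4} {q : E3} (hF : ContDiffAt ℝ 2 F q)
    (hN : DifferentiableAt ℝ N q) (hi : Function.Injective (fderiv ℝ F q))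
    (hNu : ∀ᶠ s in 𝓝 q, IsUnitNormalAt F s (N s)) (h : HasEqualPrincipalCurvaturesAt F q) :
    ∃ ν : ℝ, ν ≠ 0 ∧ ∃ e ∈ tangentSpaceAt F q, ‖e‖ = 1 ∧ ∀ v,
      fderiv ℝ N q v = -ν • (fderiv ℝ F q v - ⟪e, fderiv ℝ F q v⟫ • e) := by
  obtain ⟨N', hN', ν, hν, e₁, he₁, e₂, he₂, hn₁, hn₂, h₁₂, hII⟩ := h
  have hNq := hNu.self_of_nhds
  have hNe : ∀ x ∈ tangentSpaceAt F q, ⟪N q, x⟫ = 0 := fun x hx =>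
    (mem_tangentSpaceAt_iff hi hNq x).1 hx
  obtain ⟨B, hB0, hB1, hB2⟩ := exists_orthonormalBasis_three hn₁ hn₂ hNq.1 h₁₂
    (by rw [real_inner_comm]; exact hNe _ he₁) (by rw [real_inner_comm]; exact hNe _ he₂)
  have hB3 : ⟪N q, B 3⟫ = 0 := by
    rw [← hB2]
    exact B.orthonormal.2 (by decide)
  have hexp : ∀ x, ⟪N q, x⟫ = 0 → x = ⟪e₁, x⟫ • e₁ + ⟪e₂, x⟫ • e₂ + ⟪B 3, x⟫ • B 3 := by
    intro x hx
    have := B.sum_repr' x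
    rw [Fin.sum_univ_four, hB0, hB1, hB2, hx] at this
    refine this.symm.trans ?_
    rw [zero_smul, add_zero]
  obtain ⟨t, ht⟩ : ∃ t : ℝ, t • N q = N' := by
    rw [← Submodule.mem_span_singleton, ← orthogonal_tangentSpaceAt hi hNq]
    exact hN'.2
  have ht0 : t ≠ 0 := by
    rintro rfl
    rw [zero_smul] at ht
    simpa [← ht] using hN'.1
  have hII' : ∀ v w, ⟪fderiv ℝ F q v, fderiv ℝ N q w⟫ =
      -(t⁻¹ * ν) * (⟪e₁, fderiv ℝ F q v⟫ * ⟪e₁, fderiv ℝ F q w⟫ +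
          ⟪e₂, fderiv ℝ F q v⟫ * ⟪e₂, fderiv ℝ F q w⟫) := by
    intro v w
    have h1 := hII v w
    rw [secondFundamentalForm, ← ht, real_inner_smul_right] at h1
    have h2 := secondFundamentalForm_eq hF hN (hNu.mono fun s hs => hs.2) v w
    rw [secondFundamentalForm] at h2
    rw [h2] at h1
    field_simp
    linarith
  refine ⟨t⁻¹ * ν, mul_ne_zero (inv_ne_zero ht0) hν, B 3,
    (mem_tangentSpaceAt_iff hi hNq _).2 hB3, B.orthonormal.1 3, fun w => ?_⟩
  have hT : ∀ x ∈ tangentSpaceAt F q, ⟪x, fderiv ℝ N q w⟫ =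
      -(t⁻¹ * ν) * (⟪e₁, x⟫ * ⟪e₁, fderiv ℝ F q w⟫ + ⟪e₂, x⟫ * ⟪e₂, fderiv ℝ F q w⟫) := by
    rintro _ ⟨v, rfl⟩
    exact hII' v w
  have hdNw := hexp _ (fderiv_inner_self_eq_zero hN (hNu.mono fun s hs => hs.1) w)
  have hdFw := hexp _ (hNe _ (fderiv_apply_mem F q w))
  have e3 := (mem_tangentSpaceAt_iff hi hNq _).2 hB3
  have h21 : ⟪e₂, e₁⟫ = 0 := by rw [real_inner_comm, h₁₂]
  have h13 : ⟪e₁, B 3⟫ = 0 := by rw [← hB0]; exact B.orthonormal.2 (by decide)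
  have h23 : ⟪e₂, B 3⟫ = 0 := by rw [← hB1]; exact B.orthonormal.2 (by decide)
  rw [hT _ he₁, hT _ he₂, hT _ e3, h₁₂, h21, h13, h23, real_inner_self_eq_norm_sq,
    real_inner_self_eq_norm_sq, hn₁, hn₂] at hdNw
  rw [hdNw, sub_eq_iff_eq_add.2 hdFw]
  module

/-- Near-point data of a bi-umbilical hypersurface: unit normal `N`, unit kernel field `e` of the
shape operator, and principal curvature `ν`. -/
structure IsAdaptedFrameAt (F N e : E3 → E4) (ν : E3 → ℝ) (s : E3) : Prop where
  smooth : ContDiffAt ℝ ∞ F s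
  smooth_normal : ContDiffAt ℝ ∞ N s
  smooth_kernel : ContDiffAt ℝ ∞ e s
  smooth_curvature : ContDiffAt ℝ ∞ ν s
  injective : Function.Injective (fderiv ℝ F s)
  normal : IsUnitNormalAt F s (N s)
  kernel_mem : e s ∈ tangentSpaceAt F s
  norm_kernel : ‖e s‖ = 1
  curvature_ne : ν s ≠ 0
  fderiv_normal : ∀ v, fderiv ℝ N s v = -ν s • (fderiv ℝ F s v - ⟪e s, fderiv ℝ F s v⟫ • e s)

/-- Pointwise choices of ν and e need not be smooth, so both are replaced by formulas: ν through the
trace of the shape operator, and e by normalising the e-component of dF v₀ for a fixed v₀. -/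
theorem exists_isAdaptedFrameAt {F : E3 → E4} {q₀ : E3}
    (hF : ∀ᶠ s in 𝓝 q₀, ContDiffAt ℝ ∞ F s)
    (hi : ∀ᶠ s in 𝓝 q₀, Function.Injective (fderiv ℝ F s))
    (h : ∀ᶠ s in 𝓝 q₀, HasEqualPrincipalCurvaturesAt F s) :
    ∃ (N e : E3 → E4) (ν : E3 → ℝ), ∀ᶠ s in 𝓝 q₀, IsAdaptedFrameAt F N e ν s := by
  obtain ⟨N, J, hNJ⟩ := exists_smooth_unitNormal hF hi.self_of_nhds
  have hpt : ∀ᶠ s in 𝓝 q₀, ∃ ν : ℝ, ν ≠ 0 ∧ ∃ e ∈ tangentSpaceAt F s, ‖e‖ = 1 ∧ ∀ v,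
      fderiv ℝ N s v = -ν • (fderiv ℝ F s v - ⟪e, fderiv ℝ F s v⟫ • e) := by
    filter_upwards [hF, hi, h, hNJ.eventually_nhds] with s h1 h2 h3 h4
    exact exists_kernel_direction (h1.of_le (by norm_cast))
      (h4.self_of_nhds.1.differentiableAt (by simp)) h2 (h4.mono fun _ h => h.2.2.1) h3
  let tr : (E3 →L[ℝ] E3) →L[ℝ] ℝ := LinearMap.toContinuousLinearMap
    ((LinearMap.trace ℝ E3) ∘ₗ ContinuousLinearMap.coeLM ℝ)
  -- `J ∘ dN` is -ν times a projection of rank two, so its trace is -2ν.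
  set ν : E3 → ℝ := fun s => -(1 / 2) * tr (J s ∘L fderiv ℝ N s) with hν
  have hpt' : ∀ᶠ s in 𝓝 q₀, ν s ≠ 0 ∧ ∃ e ∈ tangentSpaceAt F s, ‖e‖ = 1 ∧ ∀ v,
      fderiv ℝ N s v = -ν s • (fderiv ℝ F s v - ⟪e, fderiv ℝ F s v⟫ • e) := by
    filter_upwards [hpt, hNJ] with s ⟨k, hk, e, he, hen, hdN⟩ hJ
    suffices hs : ν s = k by
      rw [hs]
      exact ⟨hk, e, he, hen, hdN⟩
    have h1 : ((J s ∘L fderiv ℝ N s : E3 →L[ℝ] E3) : E3 →ₗ[ℝ] E3) = -k • (LinearMap.id -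
        LinearMap.smulRight ((innerSL ℝ e ∘L fderiv ℝ F s : E3 →L[ℝ] ℝ) : E3 →ₗ[ℝ] ℝ) (J s e)) := by
      ext1 v
      simp [hdN, hJ.2.2.2]
    obtain ⟨w, hw⟩ := he
    have h2 : fderiv ℝ F s (J s e) = e := by
      rw [← hw]
      simp [hJ.2.2.2]
    have h3 : tr (J s ∘L fderiv ℝ N s) = -k * 2 := by
      change LinearMap.trace ℝ E3 ((J s ∘L fderiv ℝ N s : E3 →L[ℝ] E3) : E3 →ₗ[ℝ] E3) = _
      rw [h1, map_smul, map_sub, LinearMap.trace_id, LinearMap.trace_smulRight]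
      simp [h2, hen]
      norm_num
    simp only [hν, h3]
    ring
  obtain ⟨-, e₀, he₀, hen₀, hdN₀⟩ := hpt'.self_of_nhds
  obtain ⟨v₀, hv₀⟩ := he₀
  -- `B` equals ⟨e, dF v₀⟩ e whichever sign of e is chosen, and is nonzero near `q₀` because dF v₀ =
  -- e₀ there.
  set B : E3 → E4 := fun s => fderiv ℝ F s v₀ + (ν s)⁻¹ • fderiv ℝ N s v₀ with hB
  have hνs : ∀ᶠ s in 𝓝 q₀, ContDiffAt ℝ ∞ ν s := by
    filter_upwards [hNJ] with s hs
    exact contDiffAt_const.mul (tr.contDiff.contDiffAt.comp s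
      (hs.2.1.clm_comp (hs.1.fderiv_right (m := ∞) (by norm_cast))))
  have hBs : ∀ᶠ s in 𝓝 q₀, ContDiffAt ℝ ∞ B s := by
    filter_upwards [hNJ, hF, hνs, hpt'] with s hs hFs hνs hp
    exact ((hFs.fderiv_right (m := ∞) (by norm_cast)).clm_apply contDiffAt_const).add
      ((hνs.inv hp.1).smul ((hs.1.fderiv_right (m := ∞) (by norm_cast)).clm_apply contDiffAt_const))
  have hBe : ∀ᶠ s in 𝓝 q₀, ∀ e : E4, (∀ v, fderiv ℝ N s v =
      -ν s • (fderiv ℝ F s v - ⟪e, fderiv ℝ F s v⟫ • e)) → B s = ⟪e, fderiv ℝ F s v₀⟫ • e := by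
    filter_upwards [hpt'] with s hs e he
    rw [hB]
    simp only [he, smul_smul]
    rw [mul_neg, inv_mul_cancel₀ hs.1]
    module
  have hB0 : ∀ᶠ s in 𝓝 q₀, B s ≠ 0 := by
    apply hBs.self_of_nhds.continuousAt.eventually_ne
    rw [hBe.self_of_nhds _ hdN₀, ← ContinuousLinearMap.coe_coe, hv₀, real_inner_self_eq_norm_sq,
      hen₀, one_pow, one_smul]
    rintro rfl
    simp at hen₀
  refine ⟨N, fun s => ‖B s‖⁻¹ • B s, ν, ?_⟩
  filter_upwards [hF, hi, hNJ, hνs, hBs, hB0, hBe, hpt'] with s h1 h2 h3 h4 h5 h6 h7 h8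
  obtain ⟨hν0, e, he, hen, hdN⟩ := h8
  have hBs := h7 e hdN
  set t := ⟪e, fderiv ℝ F s v₀⟫ with ht
  have ht0 : t ≠ 0 := by
    intro h
    rw [h, zero_smul] at hBs
    exact h6 hBs
  refine ⟨h1, h3.1, ((h5.norm ℝ h6).inv (norm_ne_zero_iff.2 h6)).smul h5, h4, h2, h3.2.2.1, ?_,
    by simp [norm_smul, h6], hν0, fun v => ?_⟩
  · rw [hBs]
    exact Submodule.smul_mem _ _ (Submodule.smul_mem _ _ he)
  · rw [hdN, hBs, norm_smul, hen, mul_one, smul_smul, real_inner_smul_left, smul_smul,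
      Real.norm_eq_abs]
    congr 3
    have : |t| ≠ 0 := abs_ne_zero.2 ht0
    field_simp
    rw [sq_abs, real_inner_smul_left]
    ring

/-! ### Codazzi equations and the structure equations of the frame. -/

open Classical in
/-- A linear form which is proportional to the rank-two tangential projection vanishes. -/
theorem eq_zero_of_smul_comm {F : E3 → E4} {q : E3} (hi : Function.Injective (fderiv ℝ F q))
    {e : E4} {θ : E3 → ℝ}
    (h : ∀ v w, θ v • (fderiv ℝ F q w - ⟪e, fderiv ℝ F q w⟫ • e) =
      θ w • (fderiv ℝ F q v - ⟪e, fderiv ℝ F q v⟫ • e)) (w : E3) : θ w = 0 := by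
  by_contra hw
  set u := fderiv ℝ F q w - ⟪e, fderiv ℝ F q w⟫ • e with hu
  have h1 : LinearMap.range (fderiv ℝ F q : E3 →ₗ[ℝ] E4) ≤
      Submodule.span ℝ (({u, e} : Finset E4) : Set E4) := by
    rintro _ ⟨v, rfl⟩
    rw [Finset.coe_pair]
    rw [Submodule.mem_span_pair]
    refine ⟨(θ w)⁻¹ * θ v, ⟪e, fderiv ℝ F q v⟫, ?_⟩
    rw [mul_smul, h v w, smul_smul, inv_mul_cancel₀ hw]
    simp
  have h2 := (Submodule.finrank_mono h1).trans (finrank_span_finset_le_card _)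
  rw [LinearMap.finrank_range_of_inj hi] at h2
  have h3 := h2.trans Finset.card_le_two
  simp at h3

/-- The integrability condition of dG = α(dF - ⟨e, dF⟩e): second derivatives of F and of G are
symmetric, so antisymmetrising the differentiated equation leaves only first derivatives. It is
applied to G = N with α = -ν and to G = e with α = μ. -/
theorem antisymm_fderiv {F G e : E3 → E4} {α : E3 → ℝ} {q : E3} (hF : ContDiffAt ℝ 2 F q)
    (hG : ContDiffAt ℝ 2 G q) (he : DifferentiableAt ℝ e q) (hα : DifferentiableAt ℝ α q)
    (h : ∀ᶠ s in 𝓝 q, ∀ v, fderiv ℝ G s v =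
      α s • (fderiv ℝ F s v - ⟪e s, fderiv ℝ F s v⟫ • e s)) (v w : E3) :
    fderiv ℝ α q w • (fderiv ℝ F q v - ⟪e q, fderiv ℝ F q v⟫ • e q) -
      fderiv ℝ α q v • (fderiv ℝ F q w - ⟪e q, fderiv ℝ F q w⟫ • e q) =
    α q • ((⟪fderiv ℝ e q w, fderiv ℝ F q v⟫ - ⟪fderiv ℝ e q v, fderiv ℝ F q w⟫) • e q +
      ⟪e q, fderiv ℝ F q v⟫ • fderiv ℝ e q w - ⟪e q, fderiv ℝ F q w⟫ • fderiv ℝ e q v) := by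
  have hd : ∀ v, DifferentiableAt ℝ (fun s => fderiv ℝ F s v) q := fun v =>
    ((hF.fderiv_right (m := 1) (by norm_num)).differentiableAt (by norm_num)).clm_apply
      (differentiableAt_const v)
  have key : ∀ v w, fderiv ℝ (fun s => fderiv ℝ G s v) q w =
      fderiv ℝ α q w • (fderiv ℝ F q v - ⟪e q, fderiv ℝ F q v⟫ • e q) +
      α q • (fderiv ℝ (fun s => fderiv ℝ F s v) q w -
        (⟪e q, fderiv ℝ (fun s => fderiv ℝ F s v) q w⟫ +
          ⟪fderiv ℝ e q w, fderiv ℝ F q v⟫) • e q - ⟪e q, fderiv ℝ F q v⟫ • fderiv ℝ e q w) := by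
    intro v w
    have h1 : (fun s => fderiv ℝ G s v) =ᶠ[𝓝 q] fun s =>
        α s • (fderiv ℝ F s v - ⟪e s, fderiv ℝ F s v⟫ • e s) := h.mono fun s hs => hs v
    have hI := he.inner ℝ (hd v)
    rw [h1.fderiv_eq, fderiv_fun_smul hα ((hd v).fun_sub (hI.fun_smul he)),
      fderiv_fun_sub (hd v) (hI.fun_smul he), fderiv_fun_smul hI he]
    simp only [add_apply, smul_apply, sub_apply, ContinuousLinearMap.smulRight_apply,
      fderiv_inner_apply ℝ he (hd v)]
    module
  have h1 := key v w
  have h2 := key w v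
  rw [fderiv_fderiv_apply_comm hG, fderiv_fderiv_apply_comm hF, h2] at h1
  linear_combination (norm := module) (-1 : ℝ) • h1

/-- Insert into Codazzi the vector ε with dF ε = e. The e-component shows that de(ε) has no
tangential part; it has no normal part since dN(ε) = 0, so de(ε) = 0. The remaining components then
give de with μ = -dν(ε)/ν. Substituting back leaves a one-form θ with θ(v) P w = θ(w) P v, which
vanishes because P has rank two. -/
theorem structure_equations {F N e : E3 → E4} {ν : E3 → ℝ} {q : E3}
    (h : ∀ᶠ s in 𝓝 q, IsAdaptedFrameAt F N e ν s) :
    ∃ μ : ℝ, ∀ v,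
      fderiv ℝ e q v = μ • (fderiv ℝ F q v - ⟪e q, fderiv ℝ F q v⟫ • e q) ∧
      fderiv ℝ ν q v = -(μ * ν q * ⟪e q, fderiv ℝ F q v⟫) := by
  have hq := h.self_of_nhds
  have hF : ContDiffAt ℝ 2 F q := hq.smooth.of_le (by norm_cast)
  have hN : ContDiffAt ℝ 2 N q := hq.smooth_normal.of_le (by norm_cast)
  have he : DifferentiableAt ℝ e q := hq.smooth_kernel.differentiableAt (by simp)
  have hν : DifferentiableAt ℝ ν q := hq.smooth_curvature.differentiableAt (by simp)
  have hν0 := hq.curvature_ne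
  have hA := antisymm_fderiv hF hN he hν.fun_neg (h.mono fun s hs => hs.fderiv_normal)
  obtain ⟨ε, hε⟩ := hq.kernel_mem
  rw [ContinuousLinearMap.coe_coe] at hε
  have hee : ⟪e q, e q⟫ = 1 := by rw [real_inner_self_eq_norm_sq, hq.norm_kernel, one_pow]
  have hde : ∀ v, ⟪e q, fderiv ℝ e q v⟫ = 0 :=
    fderiv_inner_self_eq_zero he (h.mono fun s hs => hs.norm_kernel)
  have hdν : ∀ v, fderiv ℝ (fun s => -ν s) q v = -fderiv ℝ ν q v := fun v => by simp [fderiv_fun_neg]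
  -- the derivative of `e` along `e`
  have h1 : ∀ v, ⟪fderiv ℝ e q ε, fderiv ℝ F q v⟫ = 0 := by
    intro v
    have := congrArg (fun u => ⟪e q, u⟫) (hA v ε)
    simp only [hε, hee, inner_sub_right, inner_add_right, real_inner_smul_right, hde,
      real_inner_comm (e q) (fderiv ℝ e q v)] at this
    have h2 : ν q * ⟪fderiv ℝ e q ε, fderiv ℝ F q v⟫ = 0 := by linear_combination this
    simpa [hν0] using h2
  have hNe : (fun s => ⟪e s, N s⟫) =ᶠ[𝓝 q] fun _ => (0 : ℝ) := by
    filter_upwards [h] with s hs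
    exact hs.normal.2 _ hs.kernel_mem
  have h2 : ⟪fderiv ℝ e q ε, N q⟫ = 0 := by
    have := congrArg (fun L : E3 →L[ℝ] ℝ => L ε) hNe.fderiv_eq
    simpa [fderiv_inner_apply ℝ he (hN.differentiableAt (by norm_num)), hq.fderiv_normal, hε, hee,
      hq.norm_kernel] using this
  have h3 : fderiv ℝ e q ε = 0 := by
    have hm : fderiv ℝ e q ε ∈ tangentSpaceAt F q :=
      (mem_tangentSpaceAt_iff hq.injective hq.normal _).2 (by rw [real_inner_comm, h2])
    obtain ⟨u, hu⟩ := hm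
    have := h1 u
    rw [← ContinuousLinearMap.coe_coe (fderiv ℝ F q), hu] at this
    exact inner_self_eq_zero.1 this
  have h4 : ∀ v, fderiv ℝ e q v = (-(fderiv ℝ ν q ε / ν q)) •
      (fderiv ℝ F q v - ⟪e q, fderiv ℝ F q v⟫ • e q) := by
    intro v
    have := hA v ε
    simp only [hε, hee, h3, inner_zero_left, hdν, real_inner_comm (e q) (fderiv ℝ e q v),
      hde] at this
    have h5 : ν q • fderiv ℝ e q v = (-fderiv ℝ ν q ε) •
      (fderiv ℝ F q v - ⟪e q, fderiv ℝ F q v⟫ • e q) := by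
      linear_combination (norm := module) (-1 : ℝ) • this
    rw [← inv_smul_smul₀ hν0 (fderiv ℝ e q v), h5, smul_smul]
    congr 1
    field_simp
  set μ := -(fderiv ℝ ν q ε / ν q) with hμ
  refine ⟨μ, fun v => ⟨h4 v, ?_⟩⟩
  have h5 := eq_zero_of_smul_comm hq.injective (e := e q)
    (θ := fun v => fderiv ℝ ν q v + μ * ν q * ⟪e q, fderiv ℝ F q v⟫) (fun v w => by
      have := hA v w
      have hs := real_inner_comm (fderiv ℝ F q v) (fderiv ℝ F q w)
      simp only [h4, hdν, inner_sub_left, real_inner_smul_left, hs] at this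
      linear_combination (norm := module) this) v
  linarith

theorem eventually_eq_of_fderiv_eq_zero {G : Type*} [NormedAddCommGroup G] [NormedSpace ℝ G]
    {g : E3 → G} {q : E3} (h : ∀ᶠ s in 𝓝 q, DifferentiableAt ℝ g s ∧ ∀ v, fderiv ℝ g s v = 0) :
    ∀ᶠ s in 𝓝 q, g s = g q := by
  obtain ⟨ρ, hρ, hb⟩ := Metric.eventually_nhds_iff_ball.1 h
  filter_upwards [Metric.ball_mem_nhds q hρ] with s hs
  exact Metric.isOpen_ball.is_const_of_fderiv_eq_zero (𝕜 := ℝ)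
    (convex_ball q ρ).isPreconnected (fun x hx => (hb x hx).1.differentiableWithinAt)
    (fun x hx => by ext1 v; exact (hb x hx).2 v) hs (Metric.mem_ball_self hρ)

theorem exists_dilation {F N e : E3 → E4} {ν : E3 → ℝ} {q₀ : E3}
    (h : ∀ᶠ s in 𝓝 q₀, IsAdaptedFrameAt F N e ν s) :
    ∃ μ : E3 → ℝ, ∀ᶠ s in 𝓝 q₀, ContDiffAt ℝ ∞ μ s ∧ ∀ v,
      fderiv ℝ e s v = μ s • (fderiv ℝ F s v - ⟪e s, fderiv ℝ F s v⟫ • e s) ∧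
      fderiv ℝ ν s v = -(μ s * ν s * ⟪e s, fderiv ℝ F s v⟫) ∧
      fderiv ℝ μ s v = -(μ s ^ 2 * ⟪e s, fderiv ℝ F s v⟫) := by
  obtain ⟨v₀, hv₀⟩ := h.self_of_nhds.kernel_mem
  rw [ContinuousLinearMap.coe_coe] at hv₀
  set η : E3 → ℝ := fun s => ⟪e s, fderiv ℝ F s v₀⟫ with hη
  have hηs : ∀ᶠ s in 𝓝 q₀, ContDiffAt ℝ ∞ η s := by
    filter_upwards [h] with s hs
    exact hs.smooth_kernel.inner ℝ
      ((hs.smooth.fderiv_right (m := ∞) (by norm_cast)).clm_apply contDiffAt_const)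
  have hη0 : ∀ᶠ s in 𝓝 q₀, η s ≠ 0 := by
    apply hηs.self_of_nhds.continuousAt.eventually_ne
    rw [hη]
    simp only [hv₀, real_inner_self_eq_norm_sq, h.self_of_nhds.norm_kernel]
    norm_num
  -- Solving the equation for dν at the fixed vector `v₀` exhibits μ as a smooth function; the
  -- denominator is nonzero near `q₀`.
  set μ : E3 → ℝ := fun s => -(fderiv ℝ ν s v₀ / (ν s * η s)) with hμ
  have h1 : ∀ᶠ s in 𝓝 q₀, ContDiffAt ℝ ∞ μ s ∧ ∀ v,
      fderiv ℝ e s v = μ s • (fderiv ℝ F s v - ⟪e s, fderiv ℝ F s v⟫ • e s) ∧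
      fderiv ℝ ν s v = -(μ s * ν s * ⟪e s, fderiv ℝ F s v⟫) := by
    filter_upwards [h.eventually_nhds, hηs, hη0] with s hs h2 h3
    have hs' := hs.self_of_nhds
    have hν0 := hs'.curvature_ne
    refine ⟨(((hs'.smooth_curvature.fderiv_right (m := ∞) (by norm_cast)).clm_apply
      contDiffAt_const).div (hs'.smooth_curvature.mul h2) (mul_ne_zero hν0 h3)).neg, ?_⟩
    obtain ⟨m, hm⟩ := structure_equations hs
    have : μ s = m := by
      rw [hμ]
      simp only [(hm v₀).2]
      change -(-(m * ν s * η s) / (ν s * η s)) = m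
      field_simp
    rw [this]
    exact hm
  refine ⟨μ, ?_⟩
  filter_upwards [h, h1.eventually_nhds] with s hs h2
  refine ⟨h2.self_of_nhds.1, fun v => ⟨(h2.self_of_nhds.2 v).1, (h2.self_of_nhds.2 v).2, ?_⟩⟩
  have hA := antisymm_fderiv (hs.smooth.of_le (by norm_cast))
    (hs.smooth_kernel.of_le (by norm_cast)) (hs.smooth_kernel.differentiableAt (by simp))
    (h2.self_of_nhds.1.differentiableAt (by simp)) (h2.mono fun s hs v => (hs.2 v).1)
  have h5 := eq_zero_of_smul_comm hs.injective (e := e s)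
    (θ := fun v => fderiv ℝ μ s v + μ s ^ 2 * ⟪e s, fderiv ℝ F s v⟫) (fun v w => by
      have := hA v w
      have hc := real_inner_comm (fderiv ℝ F s v) (fderiv ℝ F s w)
      simp only [(h2.self_of_nhds.2 _).1, inner_sub_left, real_inner_smul_left, hc] at this
      linear_combination (norm := module) (-1 : ℝ) • this) v
  linarith

/-! ### Local normal form: cones and cylinders over spheres. -/

/-- The hypersurface `F` near `s` as part of a cone or cylinder over a sphere, with unit normal
`N`, axis direction `A`, cotangent of the opening angle `κ`, and position `G`, `c₀`. -/
structure IsConicalAt (A G : E4) (κ c₀ : ℝ) (F N : E3 → E4) (s : E3) : Prop where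
  smooth : ContDiffAt ℝ ∞ N s
  normal : IsUnitNormalAt F s (N s)
  inner_axis : ⟪N s, A⟫ = κ
  position : ∃ σ : ℝ, σ * κ ≠ c₀ ∧ F s = G + c₀ • N s + σ • (A - κ • N s)
  rank : ∀ u : E4, ⟪N s, u⟫ = 0 → ⟪A, u⟫ = 0 → ∃ v, fderiv ℝ N s v = u

theorem exists_isConicalAt {F : E3 → E4} {q₀ : E3}
    (hF : ∀ᶠ s in 𝓝 q₀, ContDiffAt ℝ ∞ F s)
    (hi : ∀ᶠ s in 𝓝 q₀, Function.Injective (fderiv ℝ F s))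
    (h : ∀ᶠ s in 𝓝 q₀, HasEqualPrincipalCurvaturesAt F s) :
    ∃ (A G : E4) (κ c₀ : ℝ), ⟪A, A⟫ = 1 + κ ^ 2 ∧ ⟪G, A⟫ = 0 ∧
      ∃ N : E3 → E4, ∀ᶠ s in 𝓝 q₀, IsConicalAt A G κ c₀ F N s := by
  obtain ⟨N, e, ν, hfr⟩ := exists_isAdaptedFrameAt hF hi h
  obtain ⟨μ, hμ⟩ := exists_dilation hfr
  set κ := μ q₀ / ν q₀ with hκ
  have hκc : ∀ᶠ s in 𝓝 q₀, μ s = κ * ν s := by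
    have : ∀ᶠ s in 𝓝 q₀, μ s / ν s = μ q₀ / ν q₀ := by
      refine eventually_eq_of_fderiv_eq_zero (g := fun s => μ s / ν s) ?_
      filter_upwards [hfr, hμ] with s h1 h2
      have hν0 := h1.curvature_ne
      have d1 := h2.1.differentiableAt (by simp)
      have d2 := h1.smooth_curvature.differentiableAt (by simp)
      have h5 := d1.hasFDerivAt.fun_mul
        ((hasDerivAt_inv hν0).comp_hasFDerivAt s d2.hasFDerivAt)
      simp only [div_eq_mul_inv]
      refine ⟨h5.differentiableAt, fun v => ?_⟩
      have h6 := congrArg (fun L : E3 →L[ℝ] ℝ => L v) h5.fderiv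
      refine h6.trans ?_
      simp [(h2.2 v).2.1, (h2.2 v).2.2]
      field_simp
      ring
    filter_upwards [this, hfr] with s hs h1
    rw [hκ, ← hs, div_mul_cancel₀ _ h1.curvature_ne]
  set A := e q₀ + κ • N q₀ with hA
  have hAc : ∀ᶠ s in 𝓝 q₀, e s + κ • N s = A := by
    refine eventually_eq_of_fderiv_eq_zero (g := fun s => e s + κ • N s) ?_
    filter_upwards [hfr, hμ, hκc] with s h1 h2 h3
    have d1 := h1.smooth_kernel.differentiableAt (by simp)
    have d2 := h1.smooth_normal.differentiableAt (by simp)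
    refine ⟨d1.fun_add (d2.fun_const_smul κ), fun v => ?_⟩
    rw [fderiv_fun_add d1 (d2.fun_const_smul κ), fderiv_fun_const_smul d2]
    simp only [add_apply, smul_apply, (h2.2 v).1, h1.fderiv_normal, h3]
    module
  have hin : ∀ᶠ s in 𝓝 q₀, ⟪e s, e s⟫ = 1 ∧ ⟪N s, N s⟫ = 1 ∧ ⟪e s, N s⟫ = 0 ∧ ⟪N s, e s⟫ = 0 := by
    filter_upwards [hfr] with s hs
    have := hs.normal.2 _ hs.kernel_mem
    refine ⟨?_, ?_, this, by rw [real_inner_comm, this]⟩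
    · rw [real_inner_self_eq_norm_sq, hs.norm_kernel, one_pow]
    · rw [real_inner_self_eq_norm_sq, hs.normal.1, one_pow]
  have hAA : ⟪A, A⟫ = 1 + κ ^ 2 := by
    obtain ⟨h1, h2, h3, h4⟩ := hin.self_of_nhds
    simp only [hA, inner_add_left, inner_add_right, real_inner_smul_left, real_inner_smul_right,
      h1, h2, h3, h4]
    ring
  have hAA0 : ⟪A, A⟫ ≠ 0 := by
    rw [hAA]
    positivity
  -- the centre curve
  set T : E3 → E4 := fun s => F s + (ν s)⁻¹ • N s with hT
  have hTd : ∀ᶠ s in 𝓝 q₀, DifferentiableAt ℝ T s ∧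
      ∀ v, fderiv ℝ T s v = ⟪e s, fderiv ℝ F s v⟫ • A := by
    filter_upwards [hfr, hμ, hκc, hAc] with s h1 h2 h3 h4
    have hν0 := h1.curvature_ne
    have d0 := h1.smooth.differentiableAt (by simp)
    have d1 := h1.smooth_curvature.differentiableAt (by simp)
    have d2 := h1.smooth_normal.differentiableAt (by simp)
    have h5 := d0.hasFDerivAt.fun_add
      (((hasDerivAt_inv hν0).comp_hasFDerivAt s d1.hasFDerivAt).fun_smul d2.hasFDerivAt)
    refine ⟨h5.differentiableAt, fun v => ?_⟩
    have h6 := congrArg (fun L : E3 →L[ℝ] E4 => L v) h5.fderiv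
    refine h6.trans ?_
    simp only [add_apply, smul_apply, ContinuousLinearMap.smulRight_apply, Function.comp_apply,
      h1.fderiv_normal, (h2.2 v).2.1, h3, ← h4, smul_eq_mul, smul_smul]
    have e1 : (ν s)⁻¹ * -ν s = -1 := by field_simp
    have e2 : -(ν s ^ 2)⁻¹ * -(κ * ν s * ν s * ⟪e s, fderiv ℝ F s v⟫) =
      κ * ⟪e s, fderiv ℝ F s v⟫ := by field_simp
    rw [e1, e2]
    module
  -- The position of the centre along the axis; its differential is ⟨e, dF⟩.
  set σ : E3 → ℝ := fun s => ⟪A, T s⟫ / ⟪A, A⟫ with hσ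
  have hσd : ∀ᶠ s in 𝓝 q₀, DifferentiableAt ℝ σ s ∧
      ∀ v, fderiv ℝ σ s v = ⟪e s, fderiv ℝ F s v⟫ := by
    filter_upwards [hTd] with s hs
    have h5 := ((innerSL ℝ A).hasFDerivAt.comp s hs.1.hasFDerivAt).mul_const ⟪A, A⟫⁻¹
    refine ⟨h5.differentiableAt, fun v => ?_⟩
    have h6 := congrArg (fun L : E3 →L[ℝ] ℝ => L v) h5.fderiv
    refine h6.trans ?_
    simp [hs.2, -inner_self_eq_norm_sq_to_K]
    field_simp
  set G := T q₀ - σ q₀ • A with hG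
  have hGc : ∀ᶠ s in 𝓝 q₀, T s - σ s • A = G := by
    refine eventually_eq_of_fderiv_eq_zero (g := fun s => T s - σ s • A) ?_
    filter_upwards [hTd, hσd] with s h1 h2
    have h5 := h1.1.hasFDerivAt.fun_sub (h2.1.hasFDerivAt.smul_const A)
    refine ⟨h5.differentiableAt, fun v => ?_⟩
    rw [h5.fderiv]
    simp [h1.2, h2.2]
  have hGA : ⟪G, A⟫ = 0 := by
    rw [hG, inner_sub_left, real_inner_smul_left, real_inner_comm A (T q₀)]
    simp only [hσ]
    rw [div_mul_cancel₀ _ hAA0, sub_self]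
  -- The differentials of σκ and 1/ν are both κ⟨e, dF⟩, so the difference is constant. As 1/ν ≠ 0,
  -- it also gives the inequality σκ ≠ c₀.
  set c₀ := σ q₀ * κ - (ν q₀)⁻¹ with hc₀
  have hcc : ∀ᶠ s in 𝓝 q₀, σ s * κ - (ν s)⁻¹ = c₀ := by
    refine eventually_eq_of_fderiv_eq_zero (g := fun s => σ s * κ - (ν s)⁻¹) ?_
    filter_upwards [hσd, hfr, hμ, hκc] with s h1 h2 h3 h4
    have hν0 := h2.curvature_ne
    have d1 := h2.smooth_curvature.differentiableAt (by simp)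
    have h5 := (h1.1.hasFDerivAt.mul_const κ).fun_sub
      ((hasDerivAt_inv hν0).comp_hasFDerivAt s d1.hasFDerivAt)
    refine ⟨h5.differentiableAt, fun v => ?_⟩
    have h6 := congrArg (fun L : E3 →L[ℝ] ℝ => L v) h5.fderiv
    refine h6.trans ?_
    simp [h1.2, (h3.2 v).2.1, h4]
    field_simp
    ring
  refine ⟨A, G, κ, c₀, hAA, hGA, N, ?_⟩
  filter_upwards [hfr, hin, hAc, hGc, hcc] with s h1 ⟨i1, i2, i3, i4⟩ h3 h4 h5
  have hν0 := h1.curvature_ne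
  refine ⟨h1.smooth_normal, h1.normal, ?_, ⟨σ s, ?_, ?_⟩, fun u hu hu' => ?_⟩
  · rw [← h3, inner_add_right, real_inner_smul_right, i2, i4]
    ring
  · intro h6
    rw [h6] at h5
    have : (ν s)⁻¹ = 0 := by linarith
    exact hν0 (inv_eq_zero.1 this)
  · have h6 : F s = T s - (ν s)⁻¹ • N s := by simp [hT]
    rw [h6, ← h4, ← h5]
    module
  · obtain ⟨v, hv⟩ := (mem_tangentSpaceAt_iff h1.injective h1.normal u).2 hu
    rw [ContinuousLinearMap.coe_coe] at hv
    have hue : ⟪e s, u⟫ = 0 := by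
      rw [← h3, inner_add_left, real_inner_smul_left, hu] at hu'
      linarith
    refine ⟨-(ν s)⁻¹ • v, ?_⟩
    rw [map_smul, h1.fderiv_normal, hv, hue, zero_smul, sub_zero, smul_smul]
    field_simp
    simp

/-! ### Uniqueness of the conical data up to sign. -/

section Conical

variable {A G A' G' : E4} {κ c₀ κ' c₀' : ℝ} {F N N' : E3 → E4}

theorem IsConicalAt.comp {F' : E3 → E4} {τ : E3 → E3} {s : E3}
    (h : IsConicalAt A G κ c₀ F N (τ s)) (hF : DifferentiableAt ℝ F (τ s))
    (hτ : ContDiffAt ℝ ∞ τ s) (hτ' : Function.Surjective (fderiv ℝ τ s))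
    (hF' : F' =ᶠ[𝓝 s] F ∘ τ) : IsConicalAt A G κ c₀ F' (N ∘ τ) s := by
  have hd := hτ.differentiableAt (by simp)
  refine ⟨h.smooth.comp s hτ, ⟨h.normal.1, ?_⟩, h.inner_axis, ?_, fun u hu hu' => ?_⟩
  · rintro _ ⟨v, rfl⟩
    rw [ContinuousLinearMap.coe_coe, hF'.fderiv_eq, fderiv_comp s hF hd]
    exact h.normal.2 _ (fderiv_apply_mem F _ _)
  · rw [hF'.eq_of_nhds]
    exact h.position
  · obtain ⟨v, hv⟩ := h.rank u hu hu'
    obtain ⟨w, rfl⟩ := hτ' v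
    refine ⟨w, ?_⟩
    rw [fderiv_comp s (h.smooth.differentiableAt (by simp)) hd]
    exact hv

theorem IsConicalAt.smul_sign {s : E3} (h : IsConicalAt A G κ c₀ F N s) {δ ε : ℝ}
    (hδ : δ ^ 2 = 1) (hε : ε ^ 2 = 1) :
    IsConicalAt (ε • A) G (δ * ε * κ) (δ * c₀) F (fun s => δ • N s) s := by
  have hδ0 : δ ≠ 0 := by
    rintro rfl
    norm_num at hδ
  have hε0 : ε ≠ 0 := by
    rintro rfl
    norm_num at hε
  have hδn : |δ| = 1 := by rwa [← sq_eq_sq₀ (abs_nonneg _) zero_le_one, sq_abs, one_pow]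
  refine ⟨h.smooth.const_smul δ, ⟨?_, ?_⟩, ?_, ?_, fun u hu hu' => ?_⟩
  · rw [norm_smul, h.normal.1, Real.norm_eq_abs, hδn, one_mul]
  · exact Submodule.smul_mem _ _ h.normal.2
  · rw [real_inner_smul_left, real_inner_smul_right, h.inner_axis]
    ring
  · obtain ⟨σ, hσ, hp⟩ := h.position
    refine ⟨ε * σ, ?_, ?_⟩
    · intro h1
      have h2 : δ * (σ * κ) = δ * c₀ := by
        rw [← h1]
        linear_combination (-δ * σ * κ) * hε
      exact hσ (mul_left_cancel₀ hδ0 h2)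
    · rw [hp]
      simp only [smul_sub, smul_smul]
      have e1 : δ * c₀ * δ = c₀ := by linear_combination c₀ * hδ
      have e2 : ε * σ * ε = σ := by linear_combination σ * hε
      have e3 : ε * σ * (δ * ε * κ * δ) = σ * κ := by
        linear_combination σ * κ * ε ^ 2 * hδ + σ * κ * hε
      rw [e1, e2, e3]
  · rw [real_inner_smul_left] at hu hu'
    obtain ⟨v, hv⟩ := h.rank u (by simpa [hδ0] using hu) (by simpa [hε0] using hu')
    refine ⟨δ⁻¹ • v, ?_⟩
    rw [fderiv_fun_const_smul (h.smooth.differentiableAt (by simp)), map_smul, smul_apply, hv,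
      smul_smul, inv_mul_cancel₀ hδ0, one_smul]

open Classical in
theorem IsConicalAt.exists_fderiv_ne_zero {s : E3} (h : IsConicalAt A G κ c₀ F N s) :
    ∃ v, fderiv ℝ N s v ≠ 0 := by
  set S : Submodule ℝ E4 := Submodule.span ℝ (({N s, A} : Finset E4) : Set E4) with hS
  obtain ⟨u, hu, hu0⟩ : ∃ u ∈ Sᗮ, u ≠ 0 := by
    refine Submodule.exists_mem_ne_zero_of_ne_bot fun h0 => ?_
    have h4 := Submodule.finrank_add_finrank_orthogonal S
    have h2 : Module.finrank ℝ S ≤ 2 := (finrank_span_finset_le_card _).trans Finset.card_le_two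
    rw [h0] at h4
    simp at h4
    omega
  obtain ⟨v, hv⟩ := h.rank u (hu _ (Submodule.subset_span (by simp)))
    (hu _ (Submodule.subset_span (by simp)))
  exact ⟨v, by rwa [hv]⟩

/-- The normal is not locally constant, since dN ≠ 0; this is how coefficients are compared below.
-/
theorem IsConicalAt.eq_zero_of_smul_eq {s : E3} (h : IsConicalAt A G κ c₀ F N s) {k : ℝ} {w : E4}
    (hk : ∀ᶠ x in 𝓝 s, k • N x = w) : k = 0 := by
  obtain ⟨v, hv⟩ := h.exists_fderiv_ne_zero
  have h1 : (fun x => k • N x) =ᶠ[𝓝 s] fun _ => w := hk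
  have h2 := congrArg (fun L : E3 →L[ℝ] E4 => L v) h1.fderiv_eq
  rw [fderiv_fun_const_smul (h.smooth.differentiableAt (by simp))] at h2
  simpa [hv] using h2

theorem IsConicalAt.inner_fderiv {s : E3} (h : ∀ᶠ x in 𝓝 s, IsConicalAt A G κ c₀ F N x) (v : E3) :
    ⟪A, fderiv ℝ N s v⟫ = 0 := by
  have h1 : (fun x => ⟪N x, A⟫) =ᶠ[𝓝 s] fun _ => κ := h.mono fun x hx => hx.inner_axis
  have h2 := congrArg (fun L : E3 →L[ℝ] ℝ => L v) h1.fderiv_eq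
  rw [fderiv_inner_apply ℝ (h.self_of_nhds.smooth.differentiableAt (by simp))
    (differentiableAt_const A)] at h2
  rw [real_inner_comm]
  simpa using h2

/-- The normals agree up to a locally constant sign δ. Both axes are orthogonal to the range of dN,
which fills the complement of span(N, A), so A' lies in that span; non-constancy of N then forces A'
= εA. Comparing the two position formulas in the same way gives G and c₀. -/
theorem IsConicalAt.unique {q : E3} (hAA : ⟪A, A⟫ = 1 + κ ^ 2) (hGA : ⟪G, A⟫ = 0)
    (hAA' : ⟪A', A'⟫ = 1 + κ' ^ 2) (hGA' : ⟪G', A'⟫ = 0)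
    (hi : ∀ᶠ s in 𝓝 q, Function.Injective (fderiv ℝ F s))
    (h : ∀ᶠ s in 𝓝 q, IsConicalAt A G κ c₀ F N s)
    (h' : ∀ᶠ s in 𝓝 q, IsConicalAt A' G' κ' c₀' F N' s) :
    ∃ δ ε : ℝ, δ ^ 2 = 1 ∧ ε ^ 2 = 1 ∧ A' = ε • A ∧ G' = G ∧ κ' = δ * ε * κ ∧ c₀' = δ * c₀ := by
  have hNN : ∀ᶠ s in 𝓝 q, ⟪N s, N s⟫ = 1 := by
    filter_upwards [h] with s hs
    rw [real_inner_self_eq_norm_sq, hs.normal.1, one_pow]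
  -- the normals agree up to a constant sign
  have h1 : ∀ᶠ s in 𝓝 q, ⟪N s, N' s⟫ ^ 2 = 1 ∧ N' s = ⟪N s, N' s⟫ • N s := by
    filter_upwards [hi, h, h', hNN] with s hi h h' hNN
    have hm := h'.normal.2
    rw [orthogonal_tangentSpaceAt hi h.normal, Submodule.mem_span_singleton] at hm
    obtain ⟨t, ht⟩ := hm
    have ht' : ⟪N s, N' s⟫ = t := by rw [← ht, real_inner_smul_right, hNN, mul_one]
    have hn := h'.normal.1
    rw [← ht, norm_smul, h.normal.1, mul_one, Real.norm_eq_abs] at hn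
    rw [ht', ← sq_abs, hn]
    exact ⟨by norm_num, ht.symm⟩
  set δ := ⟪N q, N' q⟫ with hδ
  have hδ2 : δ ^ 2 = 1 := h1.self_of_nhds.1
  have hδ0 : δ ≠ 0 := by
    rintro h0
    rw [h0] at hδ2
    norm_num at hδ2
  have hcont : ContinuousAt (fun s => ⟪N s, N' s⟫) q :=
    h.self_of_nhds.smooth.continuousAt.inner h'.self_of_nhds.smooth.continuousAt
  have h2 : ∀ᶠ s in 𝓝 q, N' s = δ • N s := by
    -- The inner product is ±1, and the unit ball around δ excludes -δ.
    filter_upwards [h1, hcont.eventually (Metric.ball_mem_nhds _ one_pos)] with s h1 h3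
    rw [Real.dist_eq, ← hδ, abs_lt] at h3
    have : ⟪N s, N' s⟫ = δ := by
      rcases sq_eq_sq_iff_eq_or_eq_neg.1 (h1.1.trans hδ2.symm) with h | h
      · exact h
      · rw [h] at h3
        nlinarith
    rw [h1.2, this]
  have h3 : ∀ᶠ s in 𝓝 q, ⟪N s, A'⟫ = δ * κ' := by
    filter_upwards [h2, h'] with s hs h'
    have := h'.inner_axis
    rw [hs, real_inner_smul_left] at this
    linear_combination (-⟪N s, A'⟫) * hδ2 + δ * this
  set ε := ⟪A, A'⟫ - κ * (δ * κ') with hε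
  have h4 : ∀ᶠ s in 𝓝 q, A' = (δ * κ') • N s + ε • (A - κ • N s) := by
    filter_upwards [h.eventually_nhds, h2.eventually_nhds, h'.eventually_nhds, h3, hNN] with
      s hs hs2 hs' hs3 hNN
    -- The residual `u` is orthogonal to N and A, hence of the form dN(v), hence orthogonal to A'
    -- too. It is therefore orthogonal to itself.
    set u := A' - ((δ * κ') • N s + ε • (A - κ • N s)) with hu
    have hNA := hs.self_of_nhds.inner_axis
    have hAN : ⟪A, N s⟫ = κ := by rw [real_inner_comm, hNA]
    have u1 : ⟪N s, u⟫ = 0 := by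
      simp only [hu, inner_sub_right, inner_add_right, real_inner_smul_right, hNA, hNN, hs3]
      ring
    have u2 : ⟪A, u⟫ = 0 := by
      simp only [hu, inner_sub_right, inner_add_right, real_inner_smul_right, hAN, hAA]
      rw [hε]
      ring
    obtain ⟨v, hv⟩ := hs.self_of_nhds.rank u u1 u2
    have u3 : ⟪A', u⟫ = 0 := by
      have h5 := IsConicalAt.inner_fderiv hs' v
      have h6 : N' =ᶠ[𝓝 s] fun s => δ • N s := hs2
      rw [h6.fderiv_eq, fderiv_fun_const_smul (hs.self_of_nhds.smooth.differentiableAt (by simp)),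
        smul_apply, hv, real_inner_smul_right] at h5
      simpa [hδ0] using h5
    have u4 : ⟪u, u⟫ = 0 := by
      conv_lhs => lhs; rw [hu]
      simp only [inner_sub_left, inner_add_left, real_inner_smul_left, u1, u2, u3]
      ring
    exact sub_eq_zero.1 (inner_self_eq_zero.1 u4)
  have h5 : δ * κ' - ε * κ = 0 := by
    refine h.self_of_nhds.eq_zero_of_smul_eq (w := A' - ε • A) ?_
    filter_upwards [h4] with s hs
    linear_combination (norm := module) (-1 : ℝ) • hs
  have hA' : A' = ε • A := by
    have := h4.self_of_nhds
    rw [this, show δ * κ' = ε * κ by linarith]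
    module
  have hκ' : κ' = δ * ε * κ := by linear_combination (-κ') * hδ2 + δ * h5
  have hε2 : ε ^ 2 = 1 := by
    rw [hA', real_inner_smul_left, real_inner_smul_right, hAA, hκ'] at hAA'
    linear_combination hAA' + ε ^ 2 * κ ^ 2 * hδ2
  have hε0 : ε ≠ 0 := by
    rintro h0
    rw [h0] at hε2
    norm_num at hε2
  have hG'A : ⟪G', A⟫ = 0 := by
    rw [hA', real_inner_smul_right] at hGA'
    simpa [hε0] using hGA'
  set d := δ * c₀' - c₀ with hd
  have h6 : ∀ᶠ s in 𝓝 q, G - G' = d • ((1 + κ ^ 2) • N s - κ • A) := by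
    filter_upwards [h, h', h2] with s hs hs' hs2
    obtain ⟨σ, -, hσ⟩ := hs.position
    obtain ⟨σ', -, hσ'⟩ := hs'.position
    have hNA := hs.inner_axis
    rw [hσ, hs2, hA'] at hσ'
    have e1 := congrArg (fun u => ⟪u, A⟫) hσ'
    simp only [inner_add_left, inner_sub_left, real_inner_smul_left, hGA, hG'A, hNA, hAA] at e1
    have e2 : σ' * ε - σ = -(d * κ) := by
      rw [hκ'] at e1
      rw [hd]
      linear_combination -e1 + σ' * ε * κ ^ 2 * hδ2
    have e3 : κ' * δ = ε * κ := by linear_combination h5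
    have e4 : G - G' = d • N s + (σ' * ε - σ) • (A - κ • N s) := by
      rw [smul_smul κ', e3] at hσ'
      rw [hd]
      linear_combination (norm := module) hσ'
    rw [e4, e2]
    module
  have hd0 : d = 0 := by
    have : d * (1 + κ ^ 2) = 0 := by
      refine h.self_of_nhds.eq_zero_of_smul_eq (w := G - G' + (d * κ) • A) ?_
      filter_upwards [h6] with s hs
      rw [hs]
      module
    have h7 : 1 + κ ^ 2 ≠ 0 := by positivity
    simpa [h7] using this
  refine ⟨δ, ε, hδ2, hε2, hA', ?_, hκ', ?_⟩
  · have := h6.self_of_nhds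
    rw [hd0, zero_smul, sub_eq_zero] at this
    exact this.symm
  · linear_combination (-c₀') * hδ2 + δ * hd0

end Conical

/-! ### Globalisation over the connected manifold. -/

section Manifold

variable {M : Type*} [TopologicalSpace M] [ChartedSpace E3 M] {X : M → E4}

theorem mdifferentiable_of_mem_maximalAtlas {φ : OpenPartialHomeomorph M E3}
    (hφ : φ ∈ IsManifold.maximalAtlas 𝓘(ℝ, E3) ∞ M) :
    φ.MDifferentiable 𝓘(ℝ, E3) 𝓘(ℝ, E3) :=
  ⟨(contMDiffOn_of_mem_maximalAtlas hφ).mdifferentiableOn (by simp),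
    (contMDiffOn_symm_of_mem_maximalAtlas hφ).mdifferentiableOn (by simp)⟩

theorem IsBiUmbilicalFoliatedHypersurface.contDiffAt_comp_symm
    (hX : IsBiUmbilicalFoliatedHypersurface X) {φ : OpenPartialHomeomorph M E3}
    (hφ : φ ∈ IsManifold.maximalAtlas 𝓘(ℝ, E3) ∞ M) {q : E3} (hq : q ∈ φ.target) :
    ContDiffAt ℝ ∞ (X ∘ φ.symm) q :=
  ((hX.smooth _).comp q (contMDiffAt_symm_of_mem_maximalAtlas hφ hq)).contDiffAt

theorem IsBiUmbilicalFoliatedHypersurface.injective_fderiv_comp_symm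
    (hX : IsBiUmbilicalFoliatedHypersurface X) {φ : OpenPartialHomeomorph M E3}
    (hφ : φ ∈ IsManifold.maximalAtlas 𝓘(ℝ, E3) ∞ M) {q : E3} (hq : q ∈ φ.target) :
    Function.Injective (fderiv ℝ (X ∘ φ.symm) q) := by
  have hd := mdifferentiable_of_mem_maximalAtlas hφ
  rw [← mfderiv_eq_fderiv, mfderiv_comp q ((hX.smooth _).mdifferentiableAt (by simp))
    (hd.mdifferentiableAt_symm hq)]
  exact (hX.immersion _).comp (hd.symm.mfderiv_injective hq)

/-- In some chart around `p`, the hypersurface is part of the given cone or cylinder. -/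
def IsConicalNear (X : M → E4) (A G : E4) (κ c₀ : ℝ) (p : M) : Prop :=
  ∃ φ ∈ IsManifold.maximalAtlas 𝓘(ℝ, E3) ∞ M, p ∈ φ.source ∧ ∃ N : E3 → E4,
    ∀ᶠ s in 𝓝 (φ p), IsConicalAt A G κ c₀ (X ∘ φ.symm) N s

variable {A G : E4} {κ c₀ : ℝ} {p : M}

theorem IsConicalNear.in_chart (hX : IsBiUmbilicalFoliatedHypersurface X)
    (h : IsConicalNear X A G κ c₀ p) {ψ : OpenPartialHomeomorph M E3}
    (hψ : ψ ∈ IsManifold.maximalAtlas 𝓘(ℝ, E3) ∞ M) (hp : p ∈ ψ.source) :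
    ∃ N : E3 → E4, ∀ᶠ s in 𝓝 (ψ p), IsConicalAt A G κ c₀ (X ∘ ψ.symm) N s := by
  obtain ⟨φ, hφ, hpφ, N, hN⟩ := h
  set τ := ψ.symm.trans φ with hτ
  have hd : τ.MDifferentiable 𝓘(ℝ, E3) 𝓘(ℝ, E3) :=
    (mdifferentiable_of_mem_maximalAtlas hψ).symm.trans (mdifferentiable_of_mem_maximalAtlas hφ)
  have hpτ : ψ p ∈ τ.source := by simp [hτ, hp, hpφ]
  have hτp : τ (ψ p) = φ p := by simp [hτ, hp]
  have hc : Tendsto τ (𝓝 (ψ p)) (𝓝 (φ p)) := by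
    rw [← hτp]
    exact τ.continuousAt hpτ
  refine ⟨N ∘ τ, ?_⟩
  filter_upwards [hc.eventually hN, τ.open_source.mem_nhds hpτ] with s hs hsτ
  have hs1 : s ∈ ψ.target ∧ ψ.symm s ∈ φ.source := by simpa [hτ] using hsτ
  refine hs.comp ?_ ?_ ?_ ?_
  · exact (hX.contDiffAt_comp_symm hφ (φ.map_source hs1.2)).differentiableAt (by simp)
  · exact ((contMDiffAt_of_mem_maximalAtlas hφ hs1.2).comp s
      (contMDiffAt_symm_of_mem_maximalAtlas hψ hs1.1)).contDiffAt
  · rw [← mfderiv_eq_fderiv]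
    exact hd.mfderiv_surjective hsτ
  · filter_upwards [τ.open_source.mem_nhds hsτ] with x hx
    have hx1 : x ∈ ψ.target ∧ ψ.symm x ∈ φ.source := by simpa [hτ] using hx
    simp [hτ, φ.left_inv hx1.2]

theorem IsConicalNear.eventually (h : IsConicalNear X A G κ c₀ p) :
    ∀ᶠ p' in 𝓝 p, IsConicalNear X A G κ c₀ p' := by
  obtain ⟨φ, hφ, hp, N, hN⟩ := h
  filter_upwards [(φ.continuousAt hp).eventually hN.eventually_nhds,
    φ.open_source.mem_nhds hp] with p' h1 h2
  exact ⟨φ, hφ, h2, N, h1⟩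

variable [IsManifold 𝓘(ℝ, E3) ∞ M]

theorem exists_isConicalNear (hX : IsBiUmbilicalFoliatedHypersurface X) (p : M) :
    ∃ (A G : E4) (κ c₀ : ℝ), ⟪A, A⟫ = 1 + κ ^ 2 ∧ ⟪G, A⟫ = 0 ∧ IsConicalNear X A G κ c₀ p := by
  have hφ := IsManifold.chart_mem_maximalAtlas (I := 𝓘(ℝ, E3)) (n := ∞) p
  have hp := mem_chart_source E3 p
  have ht := (chartAt E3 p).open_target.mem_nhds ((chartAt E3 p).map_source hp)
  obtain ⟨A, G, κ, c₀, h1, h2, N, h3⟩ := exists_isConicalAt (F := X ∘ (chartAt E3 p).symm)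
    (q₀ := chartAt E3 p p)
    (by filter_upwards [ht] with s hs using hX.contDiffAt_comp_symm hφ hs)
    (by filter_upwards [ht] with s hs using hX.injective_fderiv_comp_symm hφ hs)
    (by filter_upwards [ht] with s hs using (hX.biUmbilical _ hφ s hs).2)
  exact ⟨A, G, κ, c₀, h1, h2, _, hφ, hp, N, h3⟩

theorem exists_forall_isConicalNear [ConnectedSpace M]
    (hX : IsBiUmbilicalFoliatedHypersurface X) :
    ∃ (A G : E4) (κ c₀ : ℝ), ⟪A, A⟫ = 1 + κ ^ 2 ∧ ⟪G, A⟫ = 0 ∧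
      ∀ p, IsConicalNear X A G κ c₀ p := by
  obtain ⟨p₀⟩ := (inferInstance : Nonempty M)
  obtain ⟨A, G, κ, c₀, hAA, hGA, h₀⟩ := exists_isConicalNear hX p₀
  refine ⟨A, G, κ, c₀, hAA, hGA, ?_⟩
  -- Openness is immediate. At a limit point, local data exist and overlap the given ones at a
  -- nearby point; uniqueness there makes them equal up to signs, which `IsConicalAt.smul_sign`
  -- absorbs.
  have hcl : IsClopen {p | IsConicalNear X A G κ c₀ p} := by
    refine ⟨isClosed_iff_frequently.2 fun p hp => ?_,
      isOpen_iff_mem_nhds.2 fun p hp => IsConicalNear.eventually hp⟩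
    obtain ⟨A', G', κ', c₀', hAA', hGA', h'⟩ := exists_isConicalNear hX p
    obtain ⟨p', hp', hp''⟩ := (hp.and_eventually h'.eventually).exists
    obtain ⟨φ, hφ, hpφ, N', hN'⟩ := h'
    obtain ⟨ψ, hψ, hpψ, N₁, hN₁⟩ := hp''
    obtain ⟨N, hN⟩ := IsConicalNear.in_chart hX hp' hψ hpψ
    have hi : ∀ᶠ s in 𝓝 (ψ p'), Function.Injective (fderiv ℝ (X ∘ ψ.symm) s) := by
      filter_upwards [ψ.open_target.mem_nhds (ψ.map_source hpψ)] with s hs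
      exact hX.injective_fderiv_comp_symm hψ hs
    obtain ⟨δ, ε, hδ, hε, rfl, rfl, rfl, rfl⟩ :=
      IsConicalAt.unique hAA' hGA' hAA hGA hi hN₁ hN
    exact ⟨φ, hφ, hpφ, _, hN'.mono fun s hs => hs.smul_sign hδ hε⟩
  have := hcl.eq_univ ⟨p₀, h₀⟩
  intro p
  have hp : p ∈ {p | IsConicalNear X A G κ c₀ p} := by rw [this]; trivial
  exact hp

/-- The inverse function theorem makes Θ ∘ φ a chart of the maximal atlas. Restricting to the open
set `O` keeps smoothness, invertibility and `Q` valid on the whole domain. -/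
theorem exists_chart {φ : OpenPartialHomeomorph M E3}
    (hφ : φ ∈ IsManifold.maximalAtlas 𝓘(ℝ, E3) ∞ M) (hp : p ∈ φ.source) {Θ : E3 → E3}
    {Q : E3 → Prop} (h : ∀ᶠ s in 𝓝 (φ p), ContDiffAt ℝ ∞ Θ s ∧
      Function.Injective (fderiv ℝ Θ s) ∧ Q s) :
    ∃ ψ ∈ IsManifold.maximalAtlas 𝓘(ℝ, E3) ∞ M, p ∈ ψ.source ∧
      ∀ q ∈ ψ.source, q ∈ φ.source ∧ ψ q = Θ (φ q) ∧ Q (φ q) := by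
  obtain ⟨O, hO, hOo, hpO⟩ := eventually_nhds_iff.1 h
  have hequiv : ∀ s ∈ O, ∃ L : E3 ≃L[ℝ] E3, HasFDerivAt Θ (L : E3 →L[ℝ] E3) s := by
    intro s hs
    refine ⟨(LinearEquiv.ofInjectiveEndo (fderiv ℝ Θ s : E3 →ₗ[ℝ] E3)
      (hO s hs).2.1).toContinuousLinearEquiv, ?_⟩
    exact ((hO s hs).1.differentiableAt (by simp)).hasFDerivAt.congr_fderiv (by ext1 v; rfl)
  obtain ⟨L, hL⟩ := hequiv _ hpO
  set g := ((hO _ hpO).1.toOpenPartialHomeomorph Θ hL (by simp)).restrOpen O hOo with hg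
  have hgΘ : ∀ s, g s = Θ s := fun s => rfl
  have hgO : ∀ s ∈ g.source, s ∈ O := fun s hs => hs.2
  have hpg : φ p ∈ g.source :=
    ⟨ContDiffAt.mem_toOpenPartialHomeomorph_source (hO _ hpO).1 hL (by simp), hpO⟩
  refine ⟨φ.trans g, ?_, ?_, fun q hq => ?_⟩
  · apply OpenPartialHomeomorph.mem_maximalAtlas_of_contMDiffOn
    · intro q hq
      have hq' : q ∈ φ.source ∧ φ q ∈ g.source := by simpa using hq
      exact (((hO _ (hgO _ hq'.2)).1.contMDiffAt).comp q
        (contMDiffAt_of_mem_maximalAtlas hφ hq'.1)).contMDiffWithinAt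
    · intro q hq
      have hq' : q ∈ g.target ∧ g.symm q ∈ φ.target := by simpa using hq
      have hs := g.map_target hq'.1
      obtain ⟨L', hL'⟩ := hequiv _ (hgO _ hs)
      have h1 : ContDiffAt ℝ ∞ g.symm q :=
        g.contDiffAt_symm hq'.1 hL' (hO _ (hgO _ hs)).1
      exact ((contMDiffAt_symm_of_mem_maximalAtlas hφ hq'.2).comp q
        h1.contMDiffAt).contMDiffWithinAt
  · simp [hp, hpg]
  · have hq' : q ∈ φ.source ∧ φ q ∈ g.source := by simpa using hq
    exact ⟨hq'.1, rfl, (hO _ (hgO _ hq'.2)).2.2⟩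

end Manifold

/-! ### Coordinates on the sphere and recovery of the envelope. -/

/-- The coordinate `x` of the point `m` of the sphere `l`. -/
def sphereX (m : E4) : ℝ :=
  Real.arsinh (m 2 / √(m 0 ^ 2 + m 1 ^ 2))

/-- The branch of the coordinate `y` on the sphere `l` around the meridian `y₀`. -/
def sphereY (y₀ : ℝ) (m : E4) : ℝ :=
  y₀ + Real.arctan ((m 1 * Real.cos y₀ - m 0 * Real.sin y₀) /
    (m 0 * Real.cos y₀ + m 1 * Real.sin y₀))

theorem sq_add_sq_pos_of_meridian {y₀ : ℝ} {m : E4}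
    (h : 0 < m 0 * Real.cos y₀ + m 1 * Real.sin y₀) : 0 < m 0 ^ 2 + m 1 ^ 2 := by
  by_contra hn
  have h0 : m 0 = 0 := by nlinarith [sq_nonneg (m 0), sq_nonneg (m 1)]
  have h1 : m 1 = 0 := by nlinarith [sq_nonneg (m 0), sq_nonneg (m 1)]
  simp [h0, h1] at h

/-- With ρ the distance from the polar axis, sinh x = m₂/ρ forces cosh x = a/ρ. Rotating the first
two coordinates by -y₀ gives (p, t) with p > 0, so arctan(t/p) is the polar angle relative to the
meridian y₀. -/
theorem l_sphereX_sphereY {a b y₀ : ℝ} {m : E4} (ha : 0 < a) (hab : a ^ 2 + b ^ 2 = 1)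
    (hm : ‖m‖ = 1) (hb : m 3 = b) (h : 0 < m 0 * Real.cos y₀ + m 1 * Real.sin y₀) :
    l a b (sphereX m) (sphereY y₀ m) = m := by
  have hpos := sq_add_sq_pos_of_meridian h
  have hcs := Real.sin_sq_add_cos_sq y₀
  set ρ := √(m 0 ^ 2 + m 1 ^ 2) with hρ
  have hρ0 : 0 < ρ := Real.sqrt_pos.2 hpos
  have hρ2 : ρ ^ 2 = m 0 ^ 2 + m 1 ^ 2 := Real.sq_sqrt hpos.le
  have hn : m 0 ^ 2 + m 1 ^ 2 + m 2 ^ 2 = a ^ 2 := by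
    have h1 : ‖m‖ ^ 2 = 1 := by rw [hm, one_pow]
    rw [EuclideanSpace.norm_sq_eq, Fin.sum_univ_four] at h1
    simp only [Real.norm_eq_abs, sq_abs, hb] at h1
    linarith
  have hsinh : Real.sinh (sphereX m) = m 2 / ρ := Real.sinh_arsinh _
  have hcosh : Real.cosh (sphereX m) = a / ρ := by
    rw [sphereX, Real.cosh_arsinh, ← hρ, Real.sqrt_eq_iff_mul_self_eq (by positivity) (by positivity)]
    field_simp
    linarith
  set p := m 0 * Real.cos y₀ + m 1 * Real.sin y₀ with hp
  have hp0 : p ≠ 0 := h.ne'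
  have hsq : √(1 + ((m 1 * Real.cos y₀ - m 0 * Real.sin y₀) / p) ^ 2) = ρ / p := by
    rw [Real.sqrt_eq_iff_mul_self_eq (by positivity) (by positivity)]
    field_simp
    rw [hρ2, hp]
    linear_combination (m 0 ^ 2 + m 1 ^ 2) * hcs
  set t := m 1 * Real.cos y₀ - m 0 * Real.sin y₀ with ht
  have hca : Real.cos (Real.arctan (t / p)) = p / ρ := by
    rw [Real.cos_arctan, hsq, one_div_div]
  have hsa : Real.sin (Real.arctan (t / p)) = t / ρ := by
    rw [Real.sin_arctan, hsq, div_div_div_cancel_right₀ hp0]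
  have hcos : Real.cos (sphereY y₀ m) = m 0 / ρ := by
    have h0 : m 0 = Real.cos y₀ * p - Real.sin y₀ * t := by
      rw [hp, ht]
      linear_combination (-m 0) * hcs
    rw [sphereY, Real.cos_add, hca, hsa, eq_comm, h0]
    ring
  have hsin : Real.sin (sphereY y₀ m) = m 1 / ρ := by
    have h0 : m 1 = Real.sin y₀ * p + Real.cos y₀ * t := by
      rw [hp, ht]
      linear_combination (-m 1) * hcs
    rw [sphereY, Real.sin_add, hca, hsa, eq_comm, h0]
    ring
  rw [l_eq, hcos, hsin, hsinh, hcosh]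
  ext i
  fin_cases i
  · simp
    field_simp
  · simp
    field_simp
  · simp
    field_simp
  · simp [hb]

theorem contDiff_coord4 (i : Fin 4) : ContDiff ℝ ∞ (fun m : E4 => m i) :=
  (EuclideanSpace.proj i : E4 →L[ℝ] ℝ).contDiff

theorem contDiffAt_sphereX {m : E4} (h : 0 < m 0 ^ 2 + m 1 ^ 2) : ContDiffAt ℝ ∞ sphereX m := by
  have h0 := (contDiff_coord4 0).contDiffAt (x := m)
  have h1 := (contDiff_coord4 1).contDiffAt (x := m)
  have h2 := (contDiff_coord4 2).contDiffAt (x := m)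
  exact Real.contDiff_arsinh.contDiffAt.comp m
    (h2.div (((h0.pow 2).add (h1.pow 2)).sqrt h.ne') (Real.sqrt_pos.2 h).ne')

theorem contDiffAt_sphereY {y₀ : ℝ} {m : E4}
    (h : 0 < m 0 * Real.cos y₀ + m 1 * Real.sin y₀) : ContDiffAt ℝ ∞ (sphereY y₀) m := by
  have h0 := (contDiff_coord4 0).contDiffAt (x := m)
  have h1 := (contDiff_coord4 1).contDiffAt (x := m)
  exact contDiffAt_const.add (Real.contDiff_arctan.contDiffAt.comp m
    (((h1.mul contDiffAt_const).sub (h0.mul contDiffAt_const)).div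
      ((h0.mul contDiffAt_const).add (h1.mul contDiffAt_const)) h.ne'))

theorem exists_orthonormalBasis_first_last {u₀ u₃ : E4} (h₀ : ‖u₀‖ = 1) (h₃ : ‖u₃‖ = 1)
    (h₀₃ : ⟪u₀, u₃⟫ = 0) : ∃ B : OrthonormalBasis (Fin 4) ℝ E4, B 0 = u₀ ∧ B 3 = u₃ := by
  have h : Orthonormal ℝ (({0, 3} : Set (Fin 4)).domRestrict ![u₀, 0, 0, u₃]) := by
    rw [orthonormal_iff_ite]
    have h₃₀ := real_inner_comm u₀ u₃
    rintro ⟨i, hi⟩ ⟨j, hj⟩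
    simp only [Set.mem_insert_iff, Set.mem_singleton_iff] at hi hj
    rcases hi with rfl | rfl <;> rcases hj with rfl | rfl <;>
      simp [Set.domRestrict_apply, h₀, h₃, h₀₃, h₃₀]
  obtain ⟨B, hB⟩ := h.exists_orthonormalBasis_extension_of_card_eq (by simp)
  exact ⟨B, by simpa using hB 0, by simpa using hB 3⟩

section Coordinates

variable {A G : E4} {κ c₀ : ℝ} {F N : E3 → E4} {B : OrthonormalBasis (Fin 4) ℝ E4} {a : ℝ}

/-- The constants `c₀, …, c₃` attached to a cone or cylinder in an adapted orthonormal basis. -/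
def coneConstants (B : OrthonormalBasis (Fin 4) ℝ E4) (a : ℝ) (G : E4) (c₀ : ℝ) : Fin 4 → ℝ :=
  ![c₀, a * ⟪B 0, G⟫, a * ⟪B 1, G⟫, a * ⟪B 2, G⟫]

theorem repr_position (ha : 0 < a) (hB : B 3 = a • A)
    (hGA : ⟪G, A⟫ = 0) {σ : ℝ} {x m : E4} (hx : x = G + c₀ • m + σ • (A - κ • m)) :
    B.repr x = !₂[coneConstants B a G c₀ 1 / a, coneConstants B a G c₀ 2 / a,
      coneConstants B a G c₀ 3 / a, 0] + c₀ • B.repr m +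
      σ • ((!₂[0, 0, 0, 1 / a] : E4) - κ • B.repr m) := by
  have hAG : ⟪A, G⟫ = 0 := by rw [real_inner_comm, hGA]
  have h1 : B.repr G = !₂[coneConstants B a G c₀ 1 / a, coneConstants B a G c₀ 2 / a,
      coneConstants B a G c₀ 3 / a, 0] := by
    ext i
    rw [B.repr_apply_apply]
    fin_cases i
    · simp [coneConstants, ha.ne']
    · simp [coneConstants, ha.ne']
    · simp [coneConstants, ha.ne']
    · simp [hB, real_inner_smul_left, hAG]
  have h2 : B.repr A = !₂[0, 0, 0, 1 / a] := by
    have h3 : A = a⁻¹ • B 3 := by rw [hB, smul_smul, inv_mul_cancel₀ ha.ne', one_smul]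
    rw [h3, map_smul, B.repr_self]
    ext i
    fin_cases i <;> simp
  rw [hx, map_add, map_add, map_smul, map_smul, map_sub, map_smul, h1, h2]

theorem exists_envelope_coordinates (ha : 0 < a) (hB : B 3 = a • A)
    (haκ : a ^ 2 * (1 + κ ^ 2) = 1) (hAA : ⟪A, A⟫ = 1 + κ ^ 2) (hGA : ⟪G, A⟫ = 0) {q : E3}
    (hF : ∀ᶠ s in 𝓝 q, ContDiffAt ℝ ∞ F s)
    (hi : ∀ᶠ s in 𝓝 q, Function.Injective (fderiv ℝ F s))
    (h : ∀ᶠ s in 𝓝 q, IsConicalAt A G κ c₀ F N s)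
    (hq : ¬ (B.repr (F q) 0 = coneConstants B a G c₀ 1 / a ∧
      B.repr (F q) 1 = coneConstants B a G c₀ 2 / a)) :
    ∃ Θ : E3 → E3, ∀ᶠ s in 𝓝 q, ContDiffAt ℝ ∞ Θ s ∧ Function.Injective (fderiv ℝ Θ s) ∧
      F s = B.repr.symm (envelope a (a * κ) (coneConstants B a G c₀) (Θ s 0) (Θ s 1) (Θ s 2)) := by
  set c := coneConstants B a G c₀ with hc
  have hAG : ⟪A, G⟫ = 0 := by rw [real_inner_comm, hGA]
  have hab : a ^ 2 + (a * κ) ^ 2 = 1 := by linarith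
  have hrep : ∀ {σ : ℝ} {x m : E4}, x = G + c₀ • m + σ • (A - κ • m) → B.repr x = _ := fun hx =>
    repr_position ha hB hGA hx
  set m : E3 → E4 := fun s => B.repr (N s) with hm
  -- the meridian through `q`
  obtain ⟨y₀, hy₀⟩ : ∃ y₀ : ℝ, 0 < m q 0 * Real.cos y₀ + m q 1 * Real.sin y₀ := by
    -- At a pole the position formula puts F(q) on one of the excluded lines. Elsewhere y₀ can be
    -- taken as the argument of m₀ + i m₁.
    have hne : ¬ (m q 0 = 0 ∧ m q 1 = 0) := by
      rintro ⟨h0, h1⟩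
      obtain ⟨σ, -, hσ⟩ := h.self_of_nhds.position
      apply hq
      rw [hrep hσ]
      change B.repr (N q) 0 = 0 at h0
      change B.repr (N q) 1 = 0 at h1
      simp [h0, h1, hc]
    set z : ℂ := ⟨m q 0, m q 1⟩ with hz
    have hz0 : z ≠ 0 := fun h0 => hne ⟨congrArg Complex.re h0, congrArg Complex.im h0⟩
    refine ⟨z.arg, ?_⟩
    have hzn : 0 < ‖z‖ := norm_pos_iff.2 hz0
    have e1 : m q 0 = ‖z‖ * Real.cos z.arg := (Complex.norm_mul_cos_arg z).symm
    have e2 : m q 1 = ‖z‖ * Real.sin z.arg := (Complex.norm_mul_sin_arg z).symm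
    rw [e1, e2]
    have := Real.sin_sq_add_cos_sq z.arg
    nlinarith
  have hms : ∀ s, ContDiffAt ℝ ∞ N s → ContDiffAt ℝ ∞ m s := fun s hs =>
    (B.repr.toContinuousLinearEquiv : E4 →L[ℝ] E4).contDiff.contDiffAt.comp s hs
  have hpos : ∀ᶠ s in 𝓝 q, 0 < m s 0 * Real.cos y₀ + m s 1 * Real.sin y₀ := by
    have hcont : ContinuousAt m q := (hms q h.self_of_nhds.smooth).continuousAt
    have h0 : ContinuousAt (fun s => m s 0) q :=
      (contDiff_coord4 0).continuous.continuousAt.comp hcont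
    have h1 : ContinuousAt (fun s => m s 1) q :=
      (contDiff_coord4 1).continuous.continuousAt.comp hcont
    exact ((h0.mul continuousAt_const).add (h1.mul continuousAt_const)).eventually
      (lt_mem_nhds hy₀)
  -- In the basis `B` the vector κN - A is `n`, and w is the component of the envelope along `n`.
  set Θ : E3 → E3 := fun s => !₂[sphereX (m s), sphereY y₀ (m s), ⟪F s, κ • N s - A⟫] with hΘ
  have hΘs : ∀ᶠ s in 𝓝 q, ContDiffAt ℝ ∞ Θ s := by
    filter_upwards [hF, h, hpos] with s h1 h2 h3
    rw [contDiffAt_euclidean]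
    intro i
    fin_cases i
    · exact (contDiffAt_sphereX (sq_add_sq_pos_of_meridian h3)).comp s (hms s h2.smooth)
    · exact (contDiffAt_sphereY h3).comp s (hms s h2.smooth)
    · exact h1.inner ℝ ((h2.smooth.const_smul κ).sub contDiffAt_const)
  have hΘF : ∀ᶠ s in 𝓝 q, F s = B.repr.symm (envelope a (a * κ) c (Θ s 0) (Θ s 1) (Θ s 2)) := by
    filter_upwards [h, hpos] with s hs h3
    obtain ⟨σ, -, hσ⟩ := hs.position
    have hNA := hs.inner_axis
    have hNN : ⟪N s, N s⟫ = 1 := by rw [real_inner_self_eq_norm_sq, hs.normal.1, one_pow]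
    have hl : l a (a * κ) (Θ s 0) (Θ s 1) = m s := by
      refine l_sphereX_sphereY ha hab ?_ ?_ h3
      · simp [hm, hs.normal.1]
      · simp only [hm]
        rw [B.repr_apply_apply, hB, real_inner_smul_left, real_inner_comm, hNA]
    have hGN : ⟪G, N s⟫ = 1 / Real.cosh (Θ s 0) * (c 1 * Real.cos (Θ s 1) +
        c 2 * Real.sin (Θ s 1) + c 3 * Real.sinh (Θ s 0)) := by
      have e1 : ⟪G, N s⟫ = ∑ i, ⟪B i, G⟫ * m s i := by
        rw [← B.sum_inner_mul_inner G (N s)]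
        refine Finset.sum_congr rfl fun i _ => ?_
        rw [real_inner_comm]
        simp only [hm, B.repr_apply_apply]
      rw [e1, ← hl, l_eq, Fin.sum_univ_four, hB, real_inner_smul_left, hAG, hc]
      simp [coneConstants]
      ring
    have hw : Θ s 2 = κ * ⟪G, N s⟫ - σ := by
      have e1 : Θ s 2 = ⟪F s, κ • N s - A⟫ := rfl
      have hAN : ⟪A, N s⟫ = κ := by rw [real_inner_comm, hNA]
      rw [e1, hσ]
      simp only [inner_add_left, inner_sub_left, inner_sub_right, real_inner_smul_left,
        real_inner_smul_right, hNA, hNN, hAN, hAA, hGA]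
      ring
    have hh : height a (a * κ) c (Θ s 0) (Θ s 1) (Θ s 2) = -σ := by
      rw [height, hw, hGN]
      field_simp
      ring
    rw [LinearIsometryEquiv.eq_symm_apply, envelope_eq c ha.ne' hab, n_eq_sub ha.ne' hab, hl, hh,
      hrep hσ, mul_div_cancel_left₀ κ ha.ne']
    have hc0 : c 0 = c₀ := rfl
    rw [hc0]
    module
  refine ⟨Θ, ?_⟩
  filter_upwards [hΘs, hΘF.eventually_nhds, hi] with s h1 h2 h3
  refine ⟨h1, ?_, h2.self_of_nhds⟩
  set Z : E3 → E4 := fun t => B.repr.symm (envelope a (a * κ) c (t 0) (t 1) (t 2)) with hZ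
  have hZs : DifferentiableAt ℝ Z (Θ s) :=
    (((B.repr.symm.toContinuousLinearEquiv : E4 →L[ℝ] E4).contDiff.comp
      (contDiff_envelope c ha.ne' hab)).differentiable (by simp)) _
  have h4 : F =ᶠ[𝓝 s] Z ∘ Θ := h2
  -- F is an immersion that factors through Θ, so Θ is one too.
  rw [h4.fderiv_eq, fderiv_comp s hZs (h1.differentiableAt (by simp))] at h3
  exact Function.Injective.of_comp h3

end Coordinates

/-! ### Choice of the basis and the excluded lines. -/

theorem exists_envelope {M : Type*} [TopologicalSpace M] [ChartedSpace E3 M]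
    [IsManifold 𝓘(ℝ, E3) ∞ M] [ConnectedSpace M] {X : M → E4}
    (hX : IsBiUmbilicalFoliatedHypersurface X) (p₀ : M) :
    ∃ (a b : ℝ) (c : Fin 4 → ℝ) (Φ : E4 ≃ₗᵢ[ℝ] E4), 0 < a ∧ a ^ 2 + b ^ 2 = 1 ∧
      ¬ (Φ.symm (X p₀) 0 = c 1 / a ∧ Φ.symm (X p₀) 1 = c 2 / a) ∧
      ∀ p : M, ¬ (Φ.symm (X p) 0 = c 1 / a ∧ Φ.symm (X p) 1 = c 2 / a) →
        ∃ φ ∈ IsManifold.maximalAtlas 𝓘(ℝ, E3) ∞ M, p ∈ φ.source ∧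
          ∀ q ∈ φ.source, X q = Φ (envelope a b c (φ q 0) (φ q 1) (φ q 2)) := by
  obtain ⟨A, G, κ, c₀, hAA, hGA, h⟩ := exists_forall_isConicalNear hX
  have hk : 0 < 1 + κ ^ 2 := by positivity
  set a : ℝ := (√(1 + κ ^ 2))⁻¹ with ha'
  have ha : 0 < a := inv_pos.2 (Real.sqrt_pos.2 hk)
  have haκ : a ^ 2 * (1 + κ ^ 2) = 1 := by
    rw [ha', inv_pow, Real.sq_sqrt hk.le, inv_mul_cancel₀ hk.ne']
  obtain ⟨φ₀, hφ₀, hp₀, N₀, hN₀⟩ := h p₀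
  set m := N₀ (φ₀ p₀) with hm
  have hmA : ⟪m, A⟫ = κ := hN₀.self_of_nhds.inner_axis
  have hAm : ⟪A, m⟫ = κ := by rw [real_inner_comm, hmA]
  have hmm : ⟪m, m⟫ = 1 := by
    rw [real_inner_self_eq_norm_sq, hN₀.self_of_nhds.normal.1, one_pow]
  -- The normalised part of N(p₀) orthogonal to A. As first basis vector it puts N(p₀) on the
  -- equator, with first coordinate a; the first coordinate of the position at p₀ then differs from
  -- c₁/a by a(c₀ - σκ) ≠ 0, so p₀ avoids the excluded lines.
  set u := a⁻¹ • (m - (a ^ 2 * κ) • A) with hu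
  have hum : ⟪u, m⟫ = a := by
    simp only [hu, real_inner_smul_left, inner_sub_left, hmm, hAm]
    field_simp
    linarith
  obtain ⟨B, hB0, hB3⟩ := exists_orthonormalBasis_first_last (u₀ := u) (u₃ := a • A)
    (by
      rw [← sq_eq_sq₀ (norm_nonneg _) zero_le_one, ← real_inner_self_eq_norm_sq]
      simp only [hu, real_inner_smul_left, real_inner_smul_right, inner_sub_left, inner_sub_right,
        hmm, hAm, hmA, hAA]
      field_simp
      linear_combination (a ^ 2 * κ ^ 2 - 1) * haκ)
    (by
      rw [← sq_eq_sq₀ (norm_nonneg _) zero_le_one, ← real_inner_self_eq_norm_sq]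
      simp only [real_inner_smul_left, real_inner_smul_right, hAA]
      linarith)
    (by
      simp only [hu, real_inner_smul_left, real_inner_smul_right, inner_sub_left, hmA, hAA]
      field_simp
      linear_combination (-κ) * haκ)
  refine ⟨a, a * κ, coneConstants B a G c₀, B.repr.symm, ha, by linarith, ?_, fun p hp => ?_⟩
  · rintro ⟨h0, -⟩
    obtain ⟨σ, hσ0, hσ⟩ := hN₀.self_of_nhds.position
    have hXp : (X ∘ φ₀.symm) (φ₀ p₀) = X p₀ := by simp [hp₀]
    rw [hXp] at hσ
    rw [LinearIsometryEquiv.symm_symm,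
      repr_position ha hB3 hGA hσ] at h0
    have e0 : B.repr m 0 = a := by rw [B.repr_apply_apply, hB0, hum]
    rw [← hm] at h0
    simp [e0] at h0
    have e1 : a * (σ * κ - c₀) = 0 := by linarith
    exact hσ0 (sub_eq_zero.1 ((mul_eq_zero.1 e1).resolve_left ha.ne'))
  · obtain ⟨φ, hφ, hpφ, N, hN⟩ := h p
    have ht := φ.open_target.mem_nhds (φ.map_source hpφ)
    obtain ⟨Θ, hΘ⟩ := exists_envelope_coordinates (F := X ∘ φ.symm) (q := φ p) ha hB3 haκ hAA hGA
      (by filter_upwards [ht] with s hs using hX.contDiffAt_comp_symm hφ hs)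
      (by filter_upwards [ht] with s hs using hX.injective_fderiv_comp_symm hφ hs) hN
      (by simpa [hpφ] using hp)
    obtain ⟨ψ, hψ, hpψ, hq⟩ := exists_chart hφ hpφ hΘ
    refine ⟨ψ, hψ, hpψ, fun q hqψ => ?_⟩
    obtain ⟨h1, h2, h3⟩ := hq q hqψ
    rw [h2, ← h3]
    simp [h1]

end BiUmbilical

end

theorem mainTheorem2 :
    -- every connected bi-umbilical foliated semi-symmetric hypersurface is given, up to
    -- parametrization and a linear isometry, by one of the envelopes
    (∀ (M : Type*) [TopologicalSpace M] [ChartedSpace BiUmbilical.E3 M]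
        [IsManifold 𝓘(ℝ, BiUmbilical.E3) ∞ M] [ConnectedSpace M] (X : M → BiUmbilical.E4),
      BiUmbilical.IsBiUmbilicalFoliatedHypersurface X →
      ∀ p₀ : M, ∃ (a b : ℝ) (c : Fin 4 → ℝ) (Φ : BiUmbilical.E4 ≃ₗᵢ[ℝ] BiUmbilical.E4),
        0 < a ∧ a ^ 2 + b ^ 2 = 1 ∧
        ¬ (Φ.symm (X p₀) 0 = c 1 / a ∧ Φ.symm (X p₀) 1 = c 2 / a) ∧
        ∀ p : M, ¬ (Φ.symm (X p) 0 = c 1 / a ∧ Φ.symm (X p) 1 = c 2 / a) →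
          ∃ φ ∈ IsManifold.maximalAtlas 𝓘(ℝ, BiUmbilical.E3) ∞ M, p ∈ φ.source ∧
            ∀ q ∈ φ.source,
              X q = Φ (BiUmbilical.envelope a b c (φ q 0) (φ q 1) (φ q 2))) ∧
    -- the explicit form of the envelopes
    (∀ (a b : ℝ) (c : Fin 4 → ℝ), 0 < a → a ^ 2 + b ^ 2 = 1 →
      (b ≠ 0 → ∀ x y w : ℝ, BiUmbilical.envelope a b c x y w =
        BiUmbilical.f a b c x y w • BiUmbilical.n a b x y + BiUmbilical.C a b c) ∧
      (b = 0 → ∀ x y w : ℝ, BiUmbilical.envelope a b c x y w =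
        !₂[c 0 * (Real.cos y / Real.cosh x) + c 1, c 0 * (Real.sin y / Real.cosh x) + c 2,
          c 0 * (Real.sinh x / Real.cosh x) + c 3, -w])) ∧
    -- conversely, every envelope is bi-umbilical foliated semi-symmetric at its regular points
    (∀ (a b : ℝ) (c : Fin 4 → ℝ), 0 < a → a ^ 2 + b ^ 2 = 1 → ∀ q : BiUmbilical.E3,
      Function.Injective
        (fderiv ℝ (fun s : BiUmbilical.E3 => BiUmbilical.envelope a b c (s 0) (s 1) (s 2)) q) →
      BiUmbilical.IsBiUmbilicalFoliatedAt
        (fun s : BiUmbilical.E3 => BiUmbilical.envelope a b c (s 0) (s 1) (s 2)) q) := by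
  refine ⟨fun M _ _ _ _ X hX p₀ => BiUmbilical.exists_envelope hX p₀, fun a b c ha hab =>
    ⟨fun hb => BiUmbilical.envelope_eq_smul_add c ha.ne' hab hb, fun hb => ?_⟩,
    fun a b c ha hab q hi => BiUmbilical.isBiUmbilicalFoliatedAt_envelope c ha hab q hi⟩
  subst hb
  obtain rfl : a = 1 := by nlinarith
  exact BiUmbilical.envelope_one_zero c
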